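/- **Theorem (Mean Value Property).** Let $m\ge 3$ and $k\ge 0$ be integers, and let $\mathcal{C}l_m$ be the real Clifford algebra generated by $\mathbb{R}^m$ with $e_ie_j+e_je_i=-2\delta_{ij}$, normed by $|\sum_A x_Ae_A|=(\sum_A x_A^2)^{1/2}$. Write $D_x=\sum_{i=1}^m e_i\partial_{x_i}$ for the Dirac operator, let $\mathbb{B}^m$ be the open unit ball of $\mathbb{R}^m$, and let $\mathcal{M}_k$ be the space of $\mathcal{C}l_m$-valued polynomials $p(u)$ on $\mathbb{R}^m$, homogeneous of degree $k$, with $D_up=0$. Let $$P_{k,u}=1+\frac{u\,D_u}{m+2k-2}$$ be the projection, acting in the variable $u$, of the $\mathcal{C}l_m$-valued harmonic polynomials homogeneous of degree $k$ onto $\mathcal{M}_k$ along $u\mathcal{M}_{k-1}$, and let $R_kf(x,u)=P_{k,u}D_xf(x,u)$ be the Rarita–Schwinger operator. Put $c_k=\frac{m-2}{m+2k-2}$, let $\omega_{m-1}$ be the surface area of the unit sphere in $\mathbb{R}^m$, let $V$ denote Lebesgue measure, and let $\tilde{\ }$ denote the reversion of $\mathcal{C}l_m$, so that $t u\tilde t=|t|^2u-2\langle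 t,u\rangle t$ for vectors $t,u$. Let $\Omega\subset\mathbb{R}^m$ be open and let $f\in C^1(\Omega\times\mathbb{B}^m,\mathcal{M}_k)\cap C(\overline{\Omega}\times\overline{\mathbb{B}^m},\mathcal{M}_k)$, that is, $f$ is a $\mathcal{C}l_m$-valued function, $C^1$ on $\Omega\times\mathbb{B}^m$ and continuous on $\overline{\Omega}\times\overline{\mathbb{B}^m}$, such that for each $x\in\overline\Omega$ the function $u\mapsto f(x,u)$ is the restriction to $\overline{\mathbb{B}^m}$ of an element of $\mathcal{M}_k$. Suppose that $R_kf=0$ on $\Omega\times\mathbb{B}^m$. Then for all $(y,u)\in\Omega\times\mathbb{B}^m$ and all $r>0$ such that the open ball $B(y,r)$ is contained in $\Omega$, both integrals below converge absolutely and $$f(y,u)=\frac{1}{\omega_{m-1}c_k}\int_{|t|=1}P_{k,u}\big[f(y+rt,\,t u\tilde t)\big]\,dS(t) =\frac{1}{c_kV(B(y,r))}\int_{B(y,r)}P_{k,u}\Big[f\Big(x,\frac{(x-y)u\widetilde{(x-y)}}{|x-y|^2}\Big)\Big]dx ,$$ where $P_{k,u}$ is applied to the bracket as a function of $u$. -/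

import Mathlib

open MeasureTheory Metric Set

noncomputable section

namespace Fermionic

/-- The Euclidean space `ℝ^m`. -/
abbrev E (m : ℕ) := EuclideanSpace ℝ (Fin m)

/-- The negative definite quadratic form `x ↦ -|x|²` on `ℝ^m`. -/
def Q (m : ℕ) : QuadraticForm ℝ (E m) :=
  -(LinearMap.BilinMap.toQuadraticMap (innerₗ (E m)))

theorem Q_apply (m : ℕ) (x : E m) : Q m x = -inner ℝ x x := rfl

/-- The real Clifford algebra `Cl_m`, with `e_i e_j + e_j e_i = -2 δ_ij`. -/
abbrev Cl (m : ℕ) := CliffordAlgebra (Q m)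

/-- The embedding `ℝ^m → Cl_m`, identifying vectors with Clifford numbers of degree one. -/
abbrev vec (m : ℕ) : E m →ₗ[ℝ] Cl m := CliffordAlgebra.ι (Q m)

/-- The standard orthonormal basis vector `e_i` of `ℝ^m`. -/
abbrev e (m : ℕ) (i : Fin m) : E m := EuclideanSpace.single i (1 : ℝ)

theorem vec_sq (m : ℕ) (x : E m) : vec m x * vec m x = -algebraMap ℝ (Cl m) (inner ℝ x x) := by
  rw [CliffordAlgebra.ι_sq_scalar, Q_apply, map_neg]

theorem vec_mul_add_swap (m : ℕ) (x y : E m) :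
    vec m x * vec m y + vec m y * vec m x = algebraMap ℝ (Cl m) (-2 * inner ℝ x y) := by
  rw [CliffordAlgebra.ι_mul_ι_add_swap]
  congr 1
  simp only [QuadraticMap.polar, Q_apply, inner_add_left, inner_add_right, real_inner_comm x y]
  ring

theorem e_mul_add_swap (m : ℕ) (i j : Fin m) :
    vec m (e m i) * vec m (e m j) + vec m (e m j) * vec m (e m i)
      = algebraMap ℝ (Cl m) (-2 * if i = j then 1 else 0) := by
  rw [vec_mul_add_swap]
  congr 2
  simp [EuclideanSpace.inner_single_left]

/-- The basis `e_A`, `A ⊆ {1,…,m}`, of `Cl_m`. -/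
def clBasis (m : ℕ) : Module.Basis (Finset (Fin m)) ℝ (Cl m) :=
  ((EuclideanSpace.basisFun (Fin m) ℝ).toBasis.ExteriorAlgebra).map
    (CliffordAlgebra.equivExterior (Q m)).symm

theorem changeForm_prod (m : ℕ) {B : LinearMap.BilinForm ℝ (E m)}
    {Q₁ Q₂ : QuadraticForm ℝ (E m)} (h : B.toQuadraticMap = Q₂ - Q₁)
    (hB : ∀ i j, i ≠ j → B (e m i) (e m j) = 0) (l : List (Fin m)) (hl : l.Nodup) :
    CliffordAlgebra.changeForm h (l.map fun i => CliffordAlgebra.ι Q₁ (e m i)).prod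
      = (l.map fun i => CliffordAlgebra.ι Q₂ (e m i)).prod := by
  have key : ∀ (l : List (Fin m)) (i : Fin m), i ∉ l →
      CliffordAlgebra.contractLeft (B (e m i))
        (l.map fun i => CliffordAlgebra.ι Q₂ (e m i)).prod = 0 := by
    intro l
    induction l with
    | nil => intro i _; simp
    | cons a l ih =>
      intro i hi
      rw [List.mem_cons, not_or] at hi
      rw [List.map_cons, List.prod_cons, CliffordAlgebra.contractLeft_ι_mul, ih i hi.2,
        hB i a hi.1]
      simp
  induction l with
  | nil => simp
  | cons a l ih =>
    rw [List.nodup_cons] at hl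
    rw [List.map_cons, List.prod_cons, CliffordAlgebra.changeForm_ι_mul, ih hl.2, key l a hl.1]
    simp

/-- `e_A` is the product of the `e_i`, `i ∈ A`, in increasing order. -/
theorem clBasis_apply (m : ℕ) (A : Finset (Fin m)) :
    clBasis m A = ((A.sort (· ≤ ·)).map fun i => vec m (e m i)).prod := by
  apply (CliffordAlgebra.equivExterior (Q m)).injective
  rw [clBasis, Module.Basis.map_apply, LinearEquiv.apply_symm_apply, ExteriorAlgebra.basis_apply]
  have h := changeForm_prod m
    (CliffordAlgebra.changeForm.associated_neg_proof (Q := Q m)) ?_ (A.sort (· ≤ ·))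
    (A.sort_nodup _)
  · refine Eq.trans ?_ h.symm
    rw [← Finset.listMap_orderEmbOfFin_finRange A rfl]
    simp only [ExteriorAlgebra.ιMulti_family, ExteriorAlgebra.ιMulti_apply, List.ofFn_eq_map,
      List.map_map]
    congr 1
    apply List.map_congr_left
    intro i _
    simp only [Function.comp_apply, OrthonormalBasis.coe_toBasis, EuclideanSpace.basisFun_apply]
    rfl
  · intro i j hij
    have h0 : inner ℝ (e m i) (e m j) = (0 : ℝ) := by
      simp [EuclideanSpace.inner_single_left, hij]
    rw [QuadraticMap.associated_apply]
    simp only [neg_apply, Q_apply, inner_add_left, inner_add_right, h0,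
      real_inner_comm (e m i) (e m j)]
    simp

/-- The coordinates `x_A` of `x = ∑_A x_A e_A`. -/
def clCoord (m : ℕ) : Cl m →ₗ[ℝ] EuclideanSpace ℝ (Finset (Fin m)) :=
  (WithLp.linearEquiv 2 ℝ (Finset (Fin m) → ℝ)).symm.toLinearMap ∘ₗ
    (clBasis m).equivFun.toLinearMap

theorem clCoord_injective (m : ℕ) : Function.Injective (clCoord m) :=
  (WithLp.linearEquiv 2 ℝ (Finset (Fin m) → ℝ)).symm.injective.comp
    (clBasis m).equivFun.injective

/-- The norm `|x| = (∑_A x_A²)^{1/2}` of `x = ∑_A x_A e_A`. -/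
instance instNormedAddCommGroupCl (m : ℕ) : NormedAddCommGroup (Cl m) :=
  NormedAddCommGroup.induced (Cl m) (EuclideanSpace ℝ (Finset (Fin m))) (clCoord m)
    (clCoord_injective m)

instance instNormedSpaceCl (m : ℕ) : NormedSpace ℝ (Cl m) :=
  NormedSpace.induced ℝ (Cl m) (EuclideanSpace ℝ (Finset (Fin m))) (clCoord m)

theorem norm_cl (m : ℕ) (x : Cl m) : ‖x‖ = Real.sqrt (∑ A, ((clBasis m).repr x A) ^ 2) := by
  change ‖clCoord m x‖ = _
  rw [EuclideanSpace.norm_eq]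
  simp [clCoord]

/-- The Dirac operator `D h = ∑ᵢ eᵢ ∂ᵢ h`, acting on functions `ℝ^m → Cl_m`. -/
def dirac (m : ℕ) (h : E m → Cl m) (u : E m) : Cl m :=
  ∑ i, vec m (e m i) * fderiv ℝ h u (e m i)

/-- `Cl_m`-valued polynomial functions on `ℝ^m` that are homogeneous of degree `k`:
sums of `u^α a_α` over the multi-indices `α` with `|α| = k`, where `a_α ∈ Cl_m`. -/
def IsHomogeneousPoly (m k : ℕ) (p : E m → Cl m) : Prop :=
  ∃ a : (Fin m → ℕ) → Cl m,
    ∀ u, p u = ∑ α ∈ Finset.piAntidiag Finset.univ k, (∏ i, u i ^ α i) • a α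

/-- The space `M_k` of `Cl_m`-valued left monogenic polynomials homogeneous of degree `k`. -/
def monogenicPoly (m k : ℕ) : Set (E m → Cl m) :=
  {p | IsHomogeneousPoly m k p ∧ ∀ u, dirac m p u = 0}

/-- The projection `P_k = 1 + u D_u / (m + 2k - 2)` from the harmonic polynomials homogeneous of
degree `k` onto `M_k`, along `u M_{k-1}` (see `fischerProj_monogenic` and
`fischerProj_add_mul`). -/
def fischerProj (m k : ℕ) (h : E m → Cl m) (u : E m) : Cl m :=
  h u + ((m : ℝ) + 2 * k - 2)⁻¹ • (vec m u * dirac m h u)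

theorem fischerProj_monogenic (m k : ℕ) {p : E m → Cl m} (hp : p ∈ monogenicPoly m k) :
    fischerProj m k p = p := by
  funext u
  simp [fischerProj, hp.2 u]

instance instFiniteDimensionalCl (m : ℕ) : FiniteDimensional ℝ (Cl m) :=
  (clBasis m).finiteDimensional_of_finite

/-- Multiplication in `Cl_m` as a continuous bilinear map. -/
def mulCLM (m : ℕ) : Cl m →L[ℝ] Cl m →L[ℝ] Cl m :=
  LinearMap.toContinuousLinearMap
    (LinearMap.toContinuousLinearMap.toLinearMap ∘ₗ LinearMap.mul ℝ (Cl m))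

theorem IsHomogeneousPoly.differentiable {m k : ℕ} {p : E m → Cl m}
    (hp : IsHomogeneousPoly m k p) : Differentiable ℝ p := by
  obtain ⟨a, ha⟩ := hp
  rw [funext ha]
  fun_prop

theorem IsHomogeneousPoly.map_smul {m k : ℕ} {p : E m → Cl m}
    (hp : IsHomogeneousPoly m k p) (c : ℝ) (u : E m) : p (c • u) = c ^ k • p u := by
  obtain ⟨a, ha⟩ := hp
  rw [ha, ha, Finset.smul_sum]
  refine Finset.sum_congr rfl fun α hα => ?_
  rw [Finset.mem_piAntidiag] at hα
  simp only [PiLp.smul_apply, smul_eq_mul, mul_pow, Finset.prod_mul_distrib,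
    Finset.prod_pow_eq_pow_sum, hα.1, smul_smul]

/-- Euler's identity. -/
theorem IsHomogeneousPoly.euler {m k : ℕ} {p : E m → Cl m}
    (hp : IsHomogeneousPoly m k p) (u : E m) : fderiv ℝ p u u = (k : ℝ) • p u := by
  have h1 : HasDerivAt (fun s : ℝ => p (s • u)) (fderiv ℝ p u u) 1 := by
    have hl : HasDerivAt (fun s : ℝ => s • u) u 1 := by
      simpa using (hasDerivAt_id (1 : ℝ)).smul_const u
    have hd : HasFDerivAt p (fderiv ℝ p u) ((1 : ℝ) • u) := by
      rw [one_smul]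
      exact (hp.differentiable u).hasFDerivAt
    exact hd.comp_hasDerivAt (1 : ℝ) hl
  have h2 : HasDerivAt (fun s : ℝ => p (s • u)) ((k : ℝ) • p u) 1 := by
    simp only [hp.map_smul]
    simpa using (hasDerivAt_pow k (1 : ℝ)).smul_const (p u)
  exact h1.unique h2

/-- `D_u (u q) = -(m + 2 (k + 1) - 2) q` for `q ∈ M_k`. -/
theorem dirac_mul (m k : ℕ) {q : E m → Cl m} (hq : q ∈ monogenicPoly m k) (u : E m) :
    dirac m (fun w => vec m w * q w) u = -((m : ℝ) + 2 * k) • q u := by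
  have hd : ∀ v, fderiv ℝ (fun w => vec m w * q w) u v
      = vec m v * q u + vec m u * fderiv ℝ q u v := by
    intro v
    have h1 : HasFDerivAt (fun w => vec m w) (LinearMap.toContinuousLinearMap (vec m)) u :=
      (LinearMap.toContinuousLinearMap (vec m)).hasFDerivAt
    have h2 := (mulCLM m).hasFDerivAt_of_bilinear h1 (hq.1.differentiable u).hasFDerivAt
    have h3 : fderiv ℝ (fun w => vec m w * q w) u = _ := h2.fderiv
    rw [h3]
    change vec m u * fderiv ℝ q u v + vec m v * q u = _
    rw [add_comm]
  have hu : ∑ i, u i • fderiv ℝ q u (e m i) = (k : ℝ) • q u := by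
    rw [← hq.1.euler u]
    have h := congrArg (fderiv ℝ q u) ((EuclideanSpace.basisFun (Fin m) ℝ).sum_repr u)
    rw [map_sum] at h
    simpa [EuclideanSpace.basisFun_apply] using h
  have hsq : ∀ i, vec m (e m i) * (vec m (e m i) * q u) = -q u := by
    intro i
    rw [← mul_assoc, vec_sq]
    simp
  have hsw : ∀ i (x : Cl m), vec m (e m i) * (vec m u * x)
      = -(vec m u * (vec m (e m i) * x)) - (2 : ℝ) • (u i • x) := by
    intro i x
    have h := congrArg (· * x) (vec_mul_add_swap m (e m i) u)
    simp only [add_mul, mul_assoc] at h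
    rw [← Algebra.smul_def] at h
    rw [eq_sub_iff_add_eq', ← sub_eq_zero]
    rw [← sub_eq_zero] at h
    rw [← h]
    simp [EuclideanSpace.inner_single_left, smul_smul]
    abel
  have h0 : vec m u * dirac m q u = 0 := by rw [hq.2 u, mul_zero]
  rw [dirac, Finset.mul_sum] at h0
  simp only [dirac, hd, mul_add, hsq, hsw, Finset.sum_add_distrib, Finset.sum_sub_distrib,
    Finset.sum_neg_distrib, h0, ← Finset.smul_sum, hu]
  simp [← Nat.cast_smul_eq_nsmul ℝ]
  module

/-- `P_k (p + u q) = p` for `p ∈ M_k` and `q ∈ M_{k-1}`. -/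
theorem fischerProj_add_mul (m k : ℕ) (hm : 3 ≤ m) {p q : E m → Cl m}
    (hp : p ∈ monogenicPoly m (k + 1)) (hq : q ∈ monogenicPoly m k) :
    fischerProj m (k + 1) (fun w => p w + vec m w * q w) = p := by
  funext u
  have hadd : dirac m (fun w => p w + vec m w * q w) u
      = dirac m p u + dirac m (fun w => vec m w * q w) u := by
    have hv : DifferentiableAt ℝ (fun w => vec m w * q w) u := by
      have h1 : HasFDerivAt (fun w => vec m w) (LinearMap.toContinuousLinearMap (vec m)) u :=
        (LinearMap.toContinuousLinearMap (vec m)).hasFDerivAt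
      exact ((mulCLM m).hasFDerivAt_of_bilinear h1
        (hq.1.differentiable u).hasFDerivAt).differentiableAt
    simp only [dirac]
    rw [← Finset.sum_add_distrib]
    refine Finset.sum_congr rfl fun i _ => ?_
    rw [fderiv_fun_add (hp.1.differentiable u) hv, add_apply, mul_add]
  rw [fischerProj, hadd, hp.2 u, dirac_mul m k hq u, zero_add, mul_smul_comm, smul_smul]
  have hpos : (0 : ℝ) < (m : ℝ) + 2 * k := by positivity
  have : ((m : ℝ) + 2 * ((k + 1 : ℕ) : ℝ) - 2)⁻¹ * -((m : ℝ) + 2 * k) = -1 := by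
    push_cast
    rw [show (m : ℝ) + 2 * ((k : ℝ) + 1) - 2 = m + 2 * k by ring]
    field_simp
  rw [this]
  simp

/-- The Rarita-Schwinger operator `R_k f(x,u) = P_k D_x f(x,u)`, with `P_k` acting in `u`. -/
def raritaSchwinger (m k : ℕ) (f : E m → E m → Cl m) (x u : E m) : Cl m :=
  fischerProj m k (fun w => dirac m (fun z => f z w) x) u

/-- The vector `t u t̃` (see `vec_sandwich`), where `~` is the reversion of `Cl_m`. -/
def sandwich (m : ℕ) (t u : E m) : E m := (inner ℝ t t : ℝ) • u - (2 * inner ℝ t u : ℝ) • t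

theorem vec_sandwich (m : ℕ) (t u : E m) :
    vec m (sandwich m t u) = vec m t * vec m u * CliffordAlgebra.reverse (vec m t) := by
  have h := vec_mul_add_swap m t u
  rw [CliffordAlgebra.reverse_ι, eq_sub_of_add_eq h, sub_mul, mul_assoc (vec m u), vec_sq,
    ← Algebra.smul_def, mul_neg, ← Algebra.commutes, ← Algebra.smul_def, sandwich, map_sub,
    map_smul, map_smul]
  module

/-- The surface measure on the unit sphere of `ℝ^m`. -/
def sphereMeasure (m : ℕ) : Measure (sphere (0 : E m) 1) := (volume : Measure (E m)).toSphere

/-- The area `ω_{m-1}` of the unit sphere of `ℝ^m`. -/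
def sphereArea (m : ℕ) : ℝ := (sphereMeasure m).real univ

/-- The constant `c_k = (m - 2) / (m + 2k - 2)`. -/
def cConst (m k : ℕ) : ℝ := ((m : ℝ) - 2) / ((m : ℝ) + 2 * k - 2)

/-- The function `f(x,u)` takes values in `M_k` for `x ∈ S`: as a function of `u` in the closed unit
ball, `f(x,·)` is an element of `M_k`. -/
def MonogenicValuedOn (m k : ℕ) (f : E m → E m → Cl m) (S : Set (E m)) : Prop :=
  ∀ x ∈ S, ∃ p ∈ monogenicPoly m k, EqOn (f x) p (closedBall 0 1)

end Fermionic

end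

/-!
Fix `u`, and for `x ≠ 0` let `w = x u x̃ / |x|² = u - 2 ⟨x, u⟩ x / |x|²`.
The proof is a conservation law for the flux through concentric spheres, followed by the evaluation
of the limit at the centre.

*Conservation.* For `p ∈ M_k` the fields `Fᵢ(x) = |x|^{-m} x P_{k,w}(eᵢ p)(w)` (`cauchyField`) are
obtained by pairing `eᵢ p` with the fundamental solution of `R_k`. A direct computation with
`x w = -u x`, Euler's identity and the harmonicity of `p` shows that they are divergence-free off
the origin (`divergence_cauchyField`), and `∑ xᵢ Fᵢ = -|x|^{2-m} P_{k,u}[p(w)]`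
(`sum_smul_cauchyField`). Expanding `f(y + x, ·) = ∑ⱼ cⱼ(y + x) bⱼ` in a basis of `M_k`
(`exists_monogenic_coordinates`) and using `R_k f = 0` to cancel the terms in which `cⱼ` is
differentiated, the field attached to `f` is divergence-free as well. The divergence theorem for
spherical shells (`flux_sub_flux_eq_integral_divergence`) then says that
`Φ(s) = ∫_{|t|=1} P_{k,u}[f(y + s t, t u t̃)] dS(t)` does not depend on `s ∈ (0, r)`, and by
continuity not on `s ∈ [0, r]`. That theorem is obtained by testing against radial functions,
passing to polar coordinates and applying the lemma of du Bois-Reymond.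

*The constant.* It remains to see that `Φ(0) = ω c_k f(y, u)`, that is, that the mean over the
sphere of `P_{k,u}[p(t u t̃)]` is `c_k p(u)` for `p ∈ M_k`. Put `φ(s) = ∫ p(u - s ⟨t, u⟩ t) dS(t)`.
The divergence theorem for the field `⟨x, u⟩ ∇p(u - s ⟨x, u⟩ x / |x|²)`, homogeneous of degree one,
is a second order differential equation for `φ` which says that
`(s² - 2s) φ'(s) + (2 - m - k s) φ(s)` is constant. Comparing `s = 2` with `s = 0` gives
`(m + 2k - 2) φ(2) = (m - 2) φ(0)`, where `φ(0) = ω p(u)` (`integral_comp_reflection`). As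
`p(t u t̃)` thus has the mean `c_k p(u)`, which is monogenic in `u`, applying `P_{k,u}` does not
change it (`integral_fischerProj_comp_reflection`).

The formula over the ball follows by integrating the one over spheres in polar coordinates.
-/

noncomputable section

namespace Fermionic

open scoped ContDiff

/-! ### Functions of one variable with a given weak derivative -/

section Analysis
variable {V : Type*} [NormedAddCommGroup V] [NormedSpace ℝ V]

theorem integrable_smul_of_tsupport_subset {X : Type*} [TopologicalSpace X] [MeasurableSpace X]
    [OpensMeasurableSpace X] {μ : Measure X} [IsFiniteMeasureOnCompacts μ]
    {χ : X → ℝ} {g : X → V} {U : Set X} (hU : IsOpen U) (hχ : Continuous χ)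
    (hc : HasCompactSupport χ) (hs : tsupport χ ⊆ U) (hg : ContinuousOn g U) :
    Integrable (fun x => χ x • g x) μ := by
  have hcont : Continuous (fun x => χ x • g x) := by
    refine continuous_of_tsupport fun x hx => ?_
    have hx' : x ∈ U := hs (tsupport_smul_subset_left χ g hx)
    exact hχ.continuousAt.smul (hg.continuousAt (hU.mem_nhds hx'))
  exact hcont.integrable_of_hasCompactSupport hc.smul_right

theorem exists_tsupport_subset_Icc {R : ℝ} {χ : ℝ → ℝ} (hc : HasCompactSupport χ)
    (hs : tsupport χ ⊆ Ioo 0 R) (hR : 0 < R) :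
    ∃ a b : ℝ, 0 < a ∧ a < b ∧ b < R ∧ tsupport χ ⊆ Icc a b := by
  rcases (tsupport χ).eq_empty_or_nonempty with h | h
  · exact ⟨R / 3, R / 2, by linarith, by linarith, by linarith, by simp [h]⟩
  · obtain ⟨a, ha, ha'⟩ := hc.exists_isLeast h
    obtain ⟨b, hb, hb'⟩ := hc.exists_isGreatest h
    have h1 := hs ha
    have h2 := hs hb
    refine ⟨a / 2, (b + R) / 2, by linarith [h1.1], ?_, by linarith [h2.2], fun x hx => ?_⟩
    · have := ha' hb
      linarith [h1.1, h1.2, h2.1, h2.2]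
    · exact ⟨by linarith [ha' hx, h1.1], by linarith [hb' hx, h2.2]⟩

/-- A test function with vanishing integral is the derivative of a test function. -/
theorem exists_antideriv_of_integral_eq_zero {R : ℝ} (hR : 0 < R) {g : ℝ → ℝ}
    (hg : ContDiff ℝ ∞ g) (hc : HasCompactSupport g) (hs : tsupport g ⊆ Ioo 0 R)
    (h0 : ∫ x, g x = 0) :
    ∃ χ : ℝ → ℝ, ContDiff ℝ 1 χ ∧ HasCompactSupport χ ∧ tsupport χ ⊆ Ioo 0 R ∧ deriv χ = g := by
  obtain ⟨a, b, ha, hab, hb, hsub⟩ := exists_tsupport_subset_Icc hc hs hR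
  have hz : ∀ x, x ∉ Icc a b → g x = 0 := fun x hx =>
    image_eq_zero_of_notMem_tsupport fun h => hx (hsub h)
  have hd : ∀ x, HasDerivAt (fun x => ∫ s in a..x, g s) (g x) x := fun x =>
    (hg.continuous.integral_hasStrictDerivAt a x).hasDerivAt
  have hder : deriv (fun x => ∫ s in a..x, g s) = g := funext fun x => (hd x).deriv
  have hzero : ∀ x, x ∉ Icc a b → ∫ s in a..x, g s = 0 := by
    intro x hx
    rcases lt_or_ge x a with h | h
    · rw [intervalIntegral.integral_symm, intervalIntegral.integral_of_le h.le,
        integral_Ioc_eq_integral_Ioo, setIntegral_eq_zero_of_forall_eq_zero, neg_zero]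
      exact fun s hs => hz s fun h' => absurd hs.2 (not_lt.2 h'.1)
    · have hbx : b < x := by
        by_contra! h'
        exact hx ⟨h, h'⟩
      rw [intervalIntegral.integral_of_le h, ← integral_Icc_eq_integral_Ioc, ← h0]
      refine setIntegral_eq_integral_of_forall_compl_eq_zero fun s hs => hz s fun h' => hs ?_
      exact ⟨h'.1, h'.2.trans hbx.le⟩
  have hts : tsupport (fun x => ∫ s in a..x, g s) ⊆ Icc a b := by
    refine closure_minimal (fun x hx => ?_) isClosed_Icc
    by_contra h
    exact hx (hzero x h)
  refine ⟨fun x => ∫ s in a..x, g s, ?_, ?_, ?_, hder⟩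
  · rw [contDiff_one_iff_deriv, hder]
    exact ⟨fun x => (hd x).differentiableAt, hg.continuous⟩
  · exact isCompact_Icc.of_isClosed_subset (isClosed_tsupport _) hts
  · exact hts.trans fun x hx => ⟨ha.trans_le hx.1, hx.2.trans_lt hb⟩

/-- The lemma of du Bois-Reymond: a continuous function on `(0, R)` whose weak derivative vanishes is
constant. -/
theorem eq_of_forall_integral_deriv_smul_eq_zero [CompleteSpace V] {R : ℝ}
    {Φ : ℝ → V} (hΦ : ContinuousOn Φ (Ioo 0 R))
    (h : ∀ χ : ℝ → ℝ, ContDiff ℝ 1 χ → HasCompactSupport χ → tsupport χ ⊆ Ioo 0 R →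
      ∫ x, deriv χ x • Φ x = 0) {a b : ℝ} (ha : a ∈ Ioo 0 R) (hb : b ∈ Ioo 0 R) : Φ a = Φ b := by
  have hR : 0 < R := ha.1.trans ha.2
  let ψ : ContDiffBump (R / 2) := ⟨R / 8, R / 4, by linarith, by linarith⟩
  have hψs : tsupport (ψ.normed volume) ⊆ Ioo 0 R := by
    rw [ψ.tsupport_normed_eq, Real.closedBall_eq_Icc]
    intro x hx
    have h1 : R / 2 - R / 4 ≤ x := hx.1
    have h2 : x ≤ R / 2 + R / 4 := hx.2
    exact ⟨by linarith, by linarith⟩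
  -- The constant value of `Φ` is its mean against a fixed bump function: for a test function `g`,
  -- the difference `g - (∫ g) ψ` has integral zero, hence is the derivative of a test function.
  set c : V := ∫ x, ψ.normed volume x • Φ x with hcdef
  have hae : ∀ᵐ x, x ∈ Ioo 0 R → Φ x - c = 0 := by
    refine isOpen_Ioo.ae_eq_zero_of_integral_contDiff_smul_eq_zero
      ((hΦ.sub continuousOn_const).locallyIntegrableOn measurableSet_Ioo) fun g hg hgc hgs => ?_
    have hψc : ContDiff ℝ ∞ (ψ.normed volume) := ψ.contDiff_normed
    have hψi : Integrable (ψ.normed volume) :=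
      hψc.continuous.integrable_of_hasCompactSupport ψ.hasCompactSupport_normed
    have hgi : Integrable g := hg.continuous.integrable_of_hasCompactSupport hgc
    obtain ⟨χ, hχ, hχc, hχs, hχd⟩ := exists_antideriv_of_integral_eq_zero hR
      (g := fun x => g x - (∫ s, g s) * ψ.normed volume x)
      (hg.sub (contDiff_const.mul hψc)) (hgc.sub ψ.hasCompactSupport_normed.mul_left)
      ((tsupport_sub _ _).trans (union_subset hgs ((tsupport_mul_subset_right).trans hψs))) (by
        rw [integral_sub hgi (hψi.const_mul _), integral_const_mul, ψ.integral_normed]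
        ring)
    have h1 := h χ hχ hχc hχs
    rw [hχd] at h1
    have hi1 : Integrable (fun x => g x • Φ x) :=
      integrable_smul_of_tsupport_subset isOpen_Ioo hg.continuous hgc hgs hΦ
    have hi2 : Integrable (fun x => ψ.normed volume x • Φ x) :=
      integrable_smul_of_tsupport_subset isOpen_Ioo hψc.continuous ψ.hasCompactSupport_normed
        hψs hΦ
    simp only [sub_smul, mul_smul] at h1
    have hi3 : Integrable (fun x => (∫ s, g s) • ψ.normed volume x • Φ x) := hi2.smul _
    rw [integral_sub hi1 hi3, integral_smul, ← hcdef] at h1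
    simp only [smul_sub]
    rw [integral_sub hi1 (hgi.smul_const c), integral_smul_const]
    exact h1
  have hall : EqOn Φ (fun _ => c) (Ioo 0 R) := by
    refine Measure.eqOn_open_of_ae_eq (μ := volume) ?_ isOpen_Ioo hΦ continuousOn_const
    rw [Filter.EventuallyEq, ae_restrict_iff' measurableSet_Ioo]
    filter_upwards [hae] with x hx hx'
    exact sub_eq_zero.1 (hx hx')
  rw [hall ha, hall hb]

/-- A function on `(0, R)` with weak derivative `h` is a primitive of `h`. -/
theorem sub_eq_integral_of_weak_deriv [CompleteSpace V] {R : ℝ}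
    {Φ h : ℝ → V} (hΦ : ContinuousOn Φ (Ioo 0 R)) (hh : ContinuousOn h (Ioo 0 R))
    (hw : ∀ χ : ℝ → ℝ, ContDiff ℝ 1 χ → HasCompactSupport χ → tsupport χ ⊆ Ioo 0 R →
      ∫ x, (deriv χ x • Φ x + χ x • h x) = 0) {a b : ℝ} (ha : a ∈ Ioo 0 R) (hb : b ∈ Ioo 0 R) :
    Φ b - Φ a = ∫ x in a..b, h x := by
  have hsub : ∀ x ∈ Ioo 0 R, uIcc a x ⊆ Ioo 0 R := fun x hx =>
    ordConnected_Ioo.uIcc_subset ha hx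
  have hH : ∀ x ∈ Ioo 0 R, HasDerivAt (fun x => ∫ s in a..x, h s) (h x) x := by
    intro x hx
    exact intervalIntegral.integral_hasDerivAt_right
      ((hh.mono (hsub x hx)).intervalIntegrable)
      (hh.stronglyMeasurableAtFilter isOpen_Ioo x hx) (hh.continuousAt (isOpen_Ioo.mem_nhds hx))
  have hHc : ContinuousOn (fun x => ∫ s in a..x, h s) (Ioo 0 R) := fun x hx =>
    (hH x hx).continuousAt.continuousWithinAt
  have key := eq_of_forall_integral_deriv_smul_eq_zero (hΦ.sub hHc) ?_ ha hb
  · simp only [Pi.sub_apply, intervalIntegral.integral_same, sub_zero] at key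
    rw [key]
    abel
  intro χ hχ hχc hχs
  have hχ' : Continuous (deriv χ) := hχ.continuous_deriv le_rfl
  have hχs' : tsupport (deriv χ) ⊆ Ioo 0 R := tsupport_deriv_subset.trans hχs
  have i1 : Integrable (fun x => deriv χ x • Φ x) :=
    integrable_smul_of_tsupport_subset isOpen_Ioo hχ' hχc.deriv hχs' hΦ
  have i2 : Integrable (fun x => χ x • h x) :=
    integrable_smul_of_tsupport_subset isOpen_Ioo hχ.continuous hχc hχs hh
  have i3 : Integrable (fun x => deriv χ x • ∫ s in a..x, h s) :=
    integrable_smul_of_tsupport_subset isOpen_Ioo hχ' hχc.deriv hχs' hHc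
  have i4 : Integrable (fun x => χ x • ∫ s in a..x, h s) :=
    integrable_smul_of_tsupport_subset isOpen_Ioo hχ.continuous hχc hχs hHc
  have h0 : ∫ x, (χ x • h x + deriv χ x • ∫ s in a..x, h s) = 0 := by
    refine integral_eq_zero_of_hasDerivAt_of_integrable
      (f := fun x => χ x • ∫ s in a..x, h s) (fun x => ?_) (i2.add i3) i4
    by_cases hx : x ∈ tsupport χ
    · exact ((hχ.differentiable one_ne_zero x).hasDerivAt).smul (hH x (hχs hx))
    · have h1 : χ =ᶠ[nhds x] 0 := notMem_tsupport_iff_eventuallyEq.1 hx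
      have h2 : deriv χ x = 0 := by rw [h1.deriv_eq]; simp
      rw [h1.eq_of_nhds, h2]
      simp only [Pi.zero_apply, zero_smul, add_zero]
      refine (hasDerivAt_const x (0 : V)).congr_of_eventuallyEq ?_
      filter_upwards [h1] with y hy
      simp [hy]
  have h1 := hw χ hχ hχc hχs
  rw [integral_add i1 i2] at h1
  rw [integral_add i2 i3] at h0
  simp only [Pi.sub_apply, smul_sub]
  rw [integral_sub i1 i3]
  rw [← h0] at h1
  rw [add_comm] at h1
  rw [add_left_cancel h1, sub_self]

end Analysis

/-! ### Polar coordinates and the divergence theorem for spherical shells -/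

section Polar
variable {V : Type*} [NormedAddCommGroup V] [NormedSpace ℝ V] {m : ℕ}

instance : IsFiniteMeasure (sphereMeasure m) := by
  unfold sphereMeasure; infer_instance

/-- Integration in polar coordinates. -/
theorem integral_eq_integral_polar (hm : 0 < m) {g : E m → V} (hg : Integrable g) :
    ∫ x, g x = ∫ s in Ioi (0 : ℝ), s ^ (m - 1) •
      ∫ t : sphere (0 : E m) 1, g (s • (t : E m)) ∂sphereMeasure m := by
  have : NeZero m := ⟨hm.ne'⟩
  have hmp := (volume : Measure (E m)).measurePreserving_homeomorphUnitSphereProd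
  have hemb := (homeomorphUnitSphereProd (E m)).measurableEmbedding
  have hG : (fun x : ({0}ᶜ : Set (E m)) => g x) =
      (fun z : sphere (0 : E m) 1 × Ioi (0 : ℝ) => g (z.2.1 • (z.1 : E m))) ∘
        homeomorphUnitSphereProd (E m) := by
    funext x
    have hx : ‖(x : E m)‖ ≠ 0 := norm_ne_zero_iff.2 x.2
    simp [smul_smul, mul_inv_cancel₀ hx]
  have hi : Integrable (fun z : sphere (0 : E m) 1 × Ioi (0 : ℝ) => g (z.2.1 • (z.1 : E m)))
      ((sphereMeasure m).prod (.volumeIoiPow (Module.finrank ℝ (E m) - 1))) := by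
    rw [sphereMeasure, ← hmp.integrable_comp_emb hemb, ← hG]
    have h1 : IntegrableOn g ({0}ᶜ : Set (E m)) := hg.integrableOn
    rwa [integrableOn_iff_comap_subtypeVal (measurableSet_singleton _).compl] at h1
  calc
    ∫ x, g x = ∫ x : ({(0)}ᶜ : Set (E m)), g x ∂((volume : Measure (E m)).comap (↑)) := by
      rw [integral_subtype_comap (measurableSet_singleton _).compl g, restrict_compl_singleton]
    _ = ∫ z : sphere (0 : E m) 1 × Ioi (0 : ℝ), g (z.2.1 • (z.1 : E m))
          ∂((sphereMeasure m).prod (.volumeIoiPow (Module.finrank ℝ (E m) - 1))) := by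
      rw [hG]
      exact hmp.integral_comp hemb
        fun z : sphere (0 : E m) 1 × Ioi (0 : ℝ) => g (z.2.1 • (z.1 : E m))
    _ = ∫ s : Ioi (0 : ℝ), ∫ t : sphere (0 : E m) 1, g (s.1 • (t : E m)) ∂sphereMeasure m
          ∂.volumeIoiPow (Module.finrank ℝ (E m) - 1) := integral_prod_symm _ hi
    _ = _ := by
      simp only [Measure.volumeIoiPow, ENNReal.ofReal, finrank_euclideanSpace_fin]
      rw [integral_withDensity_eq_integral_smul
          (measurable_subtype_coe.pow_const _).real_toNNReal,
        integral_subtype_comap measurableSet_Ioi fun a : ℝ => Real.toNNReal (a ^ (m - 1)) •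
          ∫ t : sphere (0 : E m) 1, g (a • (t : E m)) ∂sphereMeasure m,
        setIntegral_congr_fun measurableSet_Ioi fun x hx => ?_]
      simp only [NNReal.smul_def]
      rw [Real.coe_toNNReal _ (pow_nonneg (le_of_lt hx) _)]

theorem smul_mem_punctured_ball {R s : ℝ} (hs : s ∈ Ioo 0 R) (t : sphere (0 : E m) 1) :
    s • (t : E m) ∈ ball (0 : E m) R \ {0} := by
  have ht : ‖(t : E m)‖ = 1 := norm_eq_of_mem_sphere t
  refine ⟨?_, ?_⟩
  · rw [mem_ball_zero_iff, norm_smul, ht, mul_one, Real.norm_of_nonneg hs.1.le]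
    exact hs.2
  · rw [mem_singleton_iff, ← norm_eq_zero, norm_smul, ht, mul_one, norm_eq_zero]
    exact hs.1.ne'

/-- The integral over spheres of a function that is continuous in the parameter. -/
theorem continuousOn_integral_sphere {s : Set ℝ} {g : ℝ → sphere (0 : E m) 1 → V}
    (hs : IsOpen s) (hg : ContinuousOn g.uncurry (s ×ˢ univ)) :
    ContinuousOn (fun a => ∫ t, g a t ∂sphereMeasure m) s := by
  rw [continuousOn_iff_continuous_domRestrict]
  have : LocallyCompactSpace s := hs.locallyCompactSpace
  have h := continuous_parametric_integral_of_continuous (μ := sphereMeasure m)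
    (f := fun (a : s) t => g a t) (s := univ) ?_ isCompact_univ
  · simp only [Measure.restrict_univ] at h
    exact h
  · have := hg.comp_continuous (f := fun z : s × sphere (0 : E m) 1 => ((z.1 : ℝ), z.2))
      (by fun_prop) (fun z => ⟨z.1.2, mem_univ _⟩)
    exact this

theorem integrable_sphere {W : Type*} [NormedAddCommGroup W] {g : sphere (0 : E m) 1 → W}
    (hg : Continuous g) :
    Integrable g (sphereMeasure m) :=
  hg.integrable_of_hasCompactSupport (HasCompactSupport.of_compactSpace g)

/-- Differentiation under the integral over the sphere. -/
theorem hasDerivAt_integral_sphere {g g' : ℝ → sphere (0 : E m) 1 → V}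
    (hd : ∀ s t, HasDerivAt (fun s => g s t) (g' s t) s) (hg : ∀ s, Continuous (g s))
    (hg' : Continuous g'.uncurry) (s : ℝ) :
    HasDerivAt (fun s => ∫ t, g s t ∂sphereMeasure m) (∫ t, g' s t ∂sphereMeasure m) s := by
  obtain ⟨C, hC⟩ := ((isCompact_closedBall s 1).prod
    (isCompact_univ (X := sphere (0 : E m) 1))).exists_bound_of_continuousOn hg'.continuousOn
  refine (hasDerivAt_integral_of_dominated_loc_of_deriv_le (F' := g') (bound := fun _ => C)
    (closedBall_mem_nhds s one_pos) (.of_forall fun a => (hg a).aestronglyMeasurable)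
    (integrable_sphere (hg s)) ?_ (.of_forall fun t a ha => hC (a, t) ⟨ha, mem_univ _⟩)
    (integrable_const C) (.of_forall fun t a _ => hd a t)).2
  have : Continuous (g' s) := hg'.comp (by fun_prop : Continuous fun t => (s, t))
  exact this.aestronglyMeasurable

/-- The divergence `∑ᵢ ∂ᵢ Fᵢ` of a field with components in a normed space. -/
def divergence (F : Fin m → E m → V) (x : E m) : V := ∑ i, fderiv ℝ (F i) x (e m i)

theorem continuousOn_divergence {F : Fin m → E m → V} {U : Set (E m)} (hU : IsOpen U)
    (hF : ∀ i, ContDiffOn ℝ 1 (F i) U) : ContinuousOn (divergence F) U := by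
  unfold divergence
  refine continuousOn_finsetSum _ fun i _ => ?_
  exact ((hF i).continuousOn_fderiv_of_isOpen hU le_rfl).clm_apply continuousOn_const

/-- The integral of the divergence of `χ F` vanishes for a test function `χ`. -/
theorem integral_fderiv_smul_add_smul_divergence {F : Fin m → E m → V} {U : Set (E m)}
    (hU : IsOpen U) (hF : ∀ i, ContDiffOn ℝ 1 (F i) U) {χ : E m → ℝ} (hχ : ContDiff ℝ 1 χ)
    (hc : HasCompactSupport χ) (hs : tsupport χ ⊆ U) :
    ∫ x, ((∑ i, fderiv ℝ χ x (e m i) • F i x) + χ x • divergence F x) = 0 := by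
  have hF' : ∀ i, ContinuousOn (fun x => fderiv ℝ (F i) x (e m i)) U := fun i =>
    ((hF i).continuousOn_fderiv_of_isOpen hU le_rfl).clm_apply continuousOn_const
  have i1 : ∀ i, Integrable (fun x => fderiv ℝ χ x (e m i) • F i x) := fun i =>
    integrable_smul_of_tsupport_subset hU
      ((hχ.continuous_fderiv one_ne_zero).clm_apply continuous_const)
      (hc.fderiv_apply ℝ (e m i)) ((tsupport_fderiv_apply_subset ℝ _).trans hs) (hF i).continuousOn
  have i2 : ∀ i, Integrable (fun x => χ x • fderiv ℝ (F i) x (e m i)) := fun i =>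
    integrable_smul_of_tsupport_subset hU hχ.continuous hc hs (hF' i)
  simp only [divergence, Finset.smul_sum, ← Finset.sum_add_distrib]
  rw [integral_finsetSum Finset.univ (f := fun i x => fderiv ℝ χ x (e m i) • F i x +
    χ x • fderiv ℝ (F i) x (e m i)) fun i _ => (i1 i).add (i2 i)]
  refine Finset.sum_eq_zero fun i _ => ?_
  rw [integral_add (i1 i) (i2 i), integral_smul_fderiv_eq_neg_fderiv_smul_of_integrable (i1 i)
    (i2 i) (integrable_smul_of_tsupport_subset hU hχ.continuous hc hs (hF i).continuousOn)
    (fun x _ => hχ.differentiable one_ne_zero x)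
    (fun x hx => ((hF i).differentiableOn one_ne_zero).differentiableAt (hU.mem_nhds (hs hx))),
    add_neg_cancel]

theorem sum_smul_apply_basis {F : Type*} [NormedAddCommGroup F] [NormedSpace ℝ F] (L : E m →L[ℝ] F)
    (x : E m) : ∑ i, x i • L (e m i) = L x := by
  have h := congrArg L ((EuclideanSpace.basisFun (Fin m) ℝ).sum_repr x)
  rw [map_sum] at h
  simpa [EuclideanSpace.basisFun_apply] using h

theorem hasFDerivAt_comp_norm {η : ℝ → ℝ} {x : E m} (hx : x ≠ 0)
    (hη : DifferentiableAt ℝ η ‖x‖) :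
    HasFDerivAt (fun x : E m => η ‖x‖) ((deriv η ‖x‖ * ‖x‖⁻¹) • innerSL ℝ x) x := by
  have hx' : ‖x‖ ≠ 0 := norm_ne_zero_iff.2 hx
  have h1 : HasFDerivAt (fun x : E m => ‖x‖) (‖x‖⁻¹ • innerSL ℝ x) x := by
    have h2 := ((hasFDerivAt_id x).norm_sq).sqrt (by simpa using hx')
    simp only [id_eq, Real.sqrt_sq (norm_nonneg _)] at h2
    refine h2.congr_fderiv ?_
    ext v
    simp
    field_simp
  refine (hη.hasDerivAt.comp_hasFDerivAt x h1).congr_fderiv ?_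
  rw [smul_smul]

/-- The divergence theorem for spherical shells: the flux through the sphere of radius `s` is a
primitive of the integral of the divergence over that sphere. The field need not be defined at the
origin. -/
theorem flux_sub_flux_eq_integral_divergence [CompleteSpace V] (hm : 0 < m)
    {F : Fin m → E m → V} {R : ℝ}
    (hF : ∀ i, ContDiffOn ℝ 1 (F i) (ball 0 R \ {0})) {a b : ℝ}
    (ha : a ∈ Ioo 0 R) (hb : b ∈ Ioo 0 R) :
    b ^ (m - 1) • (∫ t : sphere (0 : E m) 1, ∑ i, (t : E m) i • F i (b • (t : E m))
        ∂sphereMeasure m) -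
      a ^ (m - 1) • (∫ t : sphere (0 : E m) 1, ∑ i, (t : E m) i • F i (a • (t : E m))
        ∂sphereMeasure m) =
      ∫ s in a..b, s ^ (m - 1) • ∫ t : sphere (0 : E m) 1, divergence F (s • (t : E m))
        ∂sphereMeasure m := by
  have hU : IsOpen (ball (0 : E m) R \ {0}) := isOpen_ball.sdiff isClosed_singleton
  have hmaps : MapsTo (fun z : ℝ × sphere (0 : E m) 1 => z.1 • (z.2 : E m)) (Ioo 0 R ×ˢ univ)
      (ball (0 : E m) R \ {0}) := fun z hz => smul_mem_punctured_ball hz.1 z.2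
  have hcm : Continuous (fun z : ℝ × sphere (0 : E m) 1 => z.1 • (z.2 : E m)) := by fun_prop
  have hti : ∀ i, Continuous (fun z : ℝ × sphere (0 : E m) 1 => (z.2 : E m) i) := fun i => by
    fun_prop
  refine sub_eq_integral_of_weak_deriv
    (Φ := fun s => s ^ (m - 1) • ∫ t : sphere (0 : E m) 1, ∑ i, (t : E m) i • F i (s • (t : E m))
        ∂sphereMeasure m) ?_ ?_ ?_ ha hb
  · refine (continuous_pow _).continuousOn.smul (continuousOn_integral_sphere isOpen_Ioo ?_)
    refine continuousOn_finsetSum _ fun i _ => (hti i).continuousOn.smul ?_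
    exact (hF i).continuousOn.comp hcm.continuousOn hmaps
  · refine (continuous_pow _).continuousOn.smul (continuousOn_integral_sphere isOpen_Ioo ?_)
    exact (continuousOn_divergence hU hF).comp hcm.continuousOn hmaps
  -- Test against the radial function `η(|x|)`, whose gradient is `η'(|x|) x / |x|`.
  intro η hη hηc hηs
  have hηd := hη.differentiable one_ne_zero
  have hsupp : tsupport (fun x : E m => η ‖x‖) ⊆ (fun x : E m => ‖x‖) ⁻¹' tsupport η :=
    closure_minimal (fun x hx => subset_tsupport η hx)
      ((isClosed_tsupport η).preimage continuous_norm)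
  have hsub : tsupport (fun x : E m => η ‖x‖) ⊆ ball 0 R \ {0} := by
    intro x hx
    have h1 : ‖x‖ ∈ Ioo 0 R := hηs (hsupp hx)
    exact ⟨mem_ball_zero_iff.2 h1.2, fun h => h1.1.ne' (by simp [mem_singleton_iff.1 h])⟩
  have hχ : ContDiff ℝ 1 (fun x : E m => η ‖x‖) := by
    refine contDiff_iff_contDiffAt.2 fun x => ?_
    by_cases hx : x ∈ tsupport fun x : E m => η ‖x‖
    · exact hη.contDiffAt.comp x (contDiffAt_norm ℝ (hsub hx).2)
    · exact contDiffAt_const.congr_of_eventuallyEq (notMem_tsupport_iff_eventuallyEq.1 hx)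
  have hχc : HasCompactSupport (fun x : E m => η ‖x‖) :=
    (isCompact_closedBall (0 : E m) R).of_isClosed_subset (isClosed_tsupport _)
      (hsub.trans (sdiff_subset.trans ball_subset_closedBall))
  have h0 := integral_fderiv_smul_add_smul_divergence hU hF hχ hχc hsub
  rw [integral_eq_integral_polar hm] at h0
  · rw [← h0, ← integral_indicator measurableSet_Ioi]
    congr 1
    funext s
    by_cases hs : s ∈ tsupport η
    · have hs' := hηs hs
      have hs0 : s ∈ Ioi (0 : ℝ) := hs'.1
      rw [indicator_of_mem hs0, smul_comm _ (s ^ (m - 1)), smul_comm _ (s ^ (m - 1)), ← smul_add,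
        ← integral_smul, ← integral_smul, ← integral_add]
      · congr 1
        refine integral_congr_ae (.of_forall fun t => ?_)
        have ht : ‖(t : E m)‖ = 1 := norm_eq_of_mem_sphere t
        have hst : ‖s • (t : E m)‖ = s := by
          rw [norm_smul, ht, mul_one, Real.norm_of_nonneg hs'.1.le]
        simp only [hst]
        congr 1
        rw [Finset.smul_sum]
        refine Finset.sum_congr rfl fun i _ => ?_
        rw [(hasFDerivAt_comp_norm (smul_mem_punctured_ball hs' t).2 (hηd _)).fderiv, hst]
        simp only [smul_apply, innerSL_apply_apply, EuclideanSpace.inner_single_right]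
        simp [smul_smul, mul_assoc, hs'.1.ne']
      · refine (integrable_sphere ?_).smul _
        refine continuous_finsetSum _ fun i _ => Continuous.smul (by fun_prop) ?_
        exact (hF i).continuousOn.comp_continuous (by fun_prop) fun t =>
          smul_mem_punctured_ball hs' t
      · refine (integrable_sphere ?_).smul _
        exact (continuousOn_divergence hU hF).comp_continuous (by fun_prop) fun t =>
          smul_mem_punctured_ball hs' t
    · have h1 : η =ᶠ[nhds s] 0 := notMem_tsupport_iff_eventuallyEq.1 hs
      have h2 : deriv η s = 0 := by rw [h1.deriv_eq]; simp
      have h3 : η s = 0 := h1.eq_of_nhds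
      rw [h2, h3, zero_smul, zero_smul, add_zero, eq_comm]
      refine indicator_apply_eq_zero.2 fun hs0 : 0 < s => ?_
      rw [integral_eq_zero_of_ae, smul_zero]
      refine .of_forall fun t => ?_
      have ht : ‖(t : E m)‖ = 1 := norm_eq_of_mem_sphere t
      have hst : ‖s • (t : E m)‖ = s := by
        rw [norm_smul, ht, mul_one, Real.norm_of_nonneg hs0.le]
      have hne : s • (t : E m) ≠ 0 := by
        rw [← norm_ne_zero_iff, hst]
        exact hs0.ne'
      simp [(hasFDerivAt_comp_norm hne (hηd _)).fderiv, hst, h2, h3]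
  · refine (integrable_finsetSum _ fun i _ => ?_).add
      (integrable_smul_of_tsupport_subset hU hχ.continuous hχc hsub (continuousOn_divergence hU hF))
    exact integrable_smul_of_tsupport_subset hU
      ((hχ.continuous_fderiv one_ne_zero).clm_apply continuous_const)
      (hχc.fderiv_apply ℝ (e m i)) ((tsupport_fderiv_apply_subset ℝ _).trans hsub)
      (hF i).continuousOn

end Polar

/-! ### Derivatives of monogenic polynomials -/

section Polynomials
variable {m k : ℕ} {p : E m → Cl m}

theorem IsHomogeneousPoly.contDiff {n : WithTop ℕ∞} (hp : IsHomogeneousPoly m k p) :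
    ContDiff ℝ n p := by
  obtain ⟨a, ha⟩ := hp
  rw [funext ha]
  fun_prop

theorem IsHomogeneousPoly.hasFDerivAt_fderiv (hp : IsHomogeneousPoly m k p) (w : E m) :
    HasFDerivAt (fderiv ℝ p) (fderiv ℝ (fderiv ℝ p) w) w :=
  ((hp.contDiff.fderiv_right (m := 1) (n := 2) le_rfl).differentiable one_ne_zero w).hasFDerivAt

theorem IsHomogeneousPoly.continuous_fderiv (hp : IsHomogeneousPoly m k p) :
    Continuous (fderiv ℝ p) := (hp.contDiff (n := 1)).continuous_fderiv one_ne_zero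

theorem IsHomogeneousPoly.continuous_fderiv_fderiv (hp : IsHomogeneousPoly m k p) :
    Continuous (fderiv ℝ (fderiv ℝ p)) :=
  (hp.contDiff.fderiv_right (m := 1) (n := 2) le_rfl).continuous_fderiv one_ne_zero

theorem IsHomogeneousPoly.fderiv_fderiv_comm (hp : IsHomogeneousPoly m k p) (w v v' : E m) :
    fderiv ℝ (fderiv ℝ p) w v v' = fderiv ℝ (fderiv ℝ p) w v' v :=
  (hp.contDiff (n := 2)).contDiffAt.isSymmSndFDerivAt (by simp) v v'

/-- Euler's identity for the derivatives of `p`, which are homogeneous of degree `k - 1`. -/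
theorem IsHomogeneousPoly.euler_fderiv (hp : IsHomogeneousPoly m k p) (w v : E m) :
    fderiv ℝ (fderiv ℝ p) w v w = ((k : ℝ) - 1) • fderiv ℝ p w v := by
  have h1 : HasFDerivAt (fun w => fderiv ℝ p w w) _ w :=
    (hp.hasFDerivAt_fderiv w).clm_apply (hasFDerivAt_id w)
  have h2 : HasFDerivAt (fun w => fderiv ℝ p w w) ((k : ℝ) • fderiv ℝ p w) w := by
    simp only [hp.euler]
    exact (hp.differentiable w).hasFDerivAt.const_smul (k : ℝ)
  have h3 := congrArg (fun L : E m →L[ℝ] Cl m => L v) (h1.unique h2)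
  simp at h3
  rw [sub_smul, one_smul, ← h3]
  abel

/-- Left multiplication by a fixed element of the Clifford algebra. -/
theorem hasFDerivAt_const_mul (a : Cl m) {g : E m → Cl m} {g' : E m →L[ℝ] Cl m} {x : E m}
    (hg : HasFDerivAt g g' x) : HasFDerivAt (fun x => a * g x) ((mulCLM m a).comp g') x :=
  ((mulCLM m a).hasFDerivAt (x := g x)).comp x hg

theorem continuous_cl_mul {X : Type*} [TopologicalSpace X] {g h : X → Cl m} (hg : Continuous g)
    (hh : Continuous h) : Continuous fun x => g x * h x :=
  ((mulCLM m).continuous.comp hg).clm_apply hh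

theorem continuous_vec : Continuous (vec m) := (vec m).continuous_of_finiteDimensional

theorem mulCLM_apply (a b : Cl m) : mulCLM m a b = a * b := rfl

theorem vec_mul_self_mul (x : E m) (a : Cl m) :
    vec m x * (vec m x * a) = -((‖x‖ ^ 2 : ℝ) • a) := by
  rw [← mul_assoc, vec_sq, real_inner_self_eq_norm_sq, neg_mul, ← Algebra.smul_def]

theorem vec_mul_vec_mul_add_swap (x y : E m) (a : Cl m) :
    vec m x * (vec m y * a) + vec m y * (vec m x * a) = (-2 * inner ℝ x y : ℝ) • a := by
  rw [← mul_assoc, ← mul_assoc, ← add_mul, vec_mul_add_swap, ← Algebra.smul_def]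

theorem sum_smul_vec (x : E m) : ∑ i, x i • vec m (e m i) = vec m x := by
  simpa using sum_smul_apply_basis (LinearMap.toContinuousLinearMap (vec m)) x

theorem sum_vec_mul_fderiv_fderiv (hp : p ∈ monogenicPoly m k) (w v : E m) :
    ∑ i, vec m (e m i) * fderiv ℝ (fderiv ℝ p) w v (e m i) = 0 := by
  have h1 : HasFDerivAt (fun w => ∑ i, vec m (e m i) * fderiv ℝ p w (e m i))
      (∑ i, (mulCLM m (vec m (e m i))).comp
        ((fderiv ℝ (fderiv ℝ p) w).flip (e m i))) w := by
    refine HasFDerivAt.fun_sum fun i _ => hasFDerivAt_const_mul _ ?_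
    refine ((hp.1.hasFDerivAt_fderiv w).clm_apply (hasFDerivAt_const (e m i) w)).congr_fderiv ?_
    ext v
    simp
  have h2 : HasFDerivAt (fun w => ∑ i, vec m (e m i) * fderiv ℝ p w (e m i))
      (0 : E m →L[ℝ] Cl m) w := by
    have : (fun w => ∑ i, vec m (e m i) * fderiv ℝ p w (e m i)) = fun _ => 0 := funext hp.2
    rw [this]
    exact hasFDerivAt_const _ _
  simpa [mulCLM_apply] using congrArg (fun L : E m →L[ℝ] Cl m => L v) (h1.unique h2)

/-- Monogenic polynomials are harmonic, since `D² = -Δ`. -/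
theorem sum_fderiv_fderiv_eq_zero (hp : p ∈ monogenicPoly m k) (w : E m) :
    ∑ i, fderiv ℝ (fderiv ℝ p) w (e m i) (e m i) = 0 := by
  -- Symmetrize `∑ⱼ eⱼ ∂ⱼ (D p) = 0` in `i, j` and use `eᵢ eⱼ + eⱼ eᵢ = -2 δᵢⱼ`.
  have h1 : ∑ j, ∑ i, vec m (e m j) * (vec m (e m i) *
      fderiv ℝ (fderiv ℝ p) w (e m j) (e m i)) = 0 := by
    refine Finset.sum_eq_zero fun j _ => ?_
    rw [← Finset.mul_sum, sum_vec_mul_fderiv_fderiv hp, mul_zero]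
  have h2 : ∑ j, ∑ i, vec m (e m i) * (vec m (e m j) *
      fderiv ℝ (fderiv ℝ p) w (e m j) (e m i)) = 0 := by
    rw [Finset.sum_comm]
    rw [← h1]
    refine Finset.sum_congr rfl fun j _ => Finset.sum_congr rfl fun i _ => ?_
    rw [hp.1.fderiv_fderiv_comm w (e m i) (e m j)]
  have h3 := congrArg₂ (· + ·) h1 h2
  simp only [← Finset.sum_add_distrib, vec_mul_vec_mul_add_swap, add_zero] at h3
  have hin : ∀ i j, inner ℝ (e m i) (e m j) = if i = j then (1 : ℝ) else 0 := fun i j => by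
    rw [EuclideanSpace.inner_single_left, PiLp.single_apply, map_one, one_mul]
  simp only [hin, mul_ite, mul_one, mul_zero, ite_smul, zero_smul, Finset.sum_ite_eq,
    Finset.mem_univ, if_true, ← Finset.smul_sum] at h3
  exact (smul_eq_zero.1 h3).resolve_left (by norm_num)

end Polynomials
/-! ### Spherical means over reflections -/

section SphericalMean
variable {m k : ℕ} {p : E m → Cl m}

/-- The vector `u - s ⟨x, u⟩ x`. For a unit vector `x` and `s = 2` it is the reflection of `u` in
the hyperplane orthogonal to `x`. -/
def shear (s : ℝ) (x u : E m) : E m := u - (s * inner ℝ x u) • x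

/-- The map `x ↦ u - s ⟨x, u⟩ x / |x|²` is constant along rays. -/
theorem shear_smul {s r : ℝ} (hr : r ≠ 0) {t : E m} (ht : ‖t‖ = 1) (u : E m) :
    shear (s * (‖r • t‖ ^ 2)⁻¹) (r • t) u = shear s t u := by
  have : ‖r • t‖ ^ 2 = r ^ 2 := by rw [norm_smul, ht, mul_one, Real.norm_eq_abs, sq_abs]
  rw [shear, shear, this, inner_smul_left, smul_smul]
  congr 2
  simp
  field_simp

theorem hasFDerivAt_inv_norm_sq {x : E m} (hx : x ≠ 0) :
    HasFDerivAt (fun x : E m => (‖x‖ ^ 2)⁻¹) (-(2 * ((‖x‖ ^ 2)⁻¹) ^ 2) • innerSL ℝ x) x := by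
  have hx' : ‖x‖ ^ 2 ≠ 0 := pow_ne_zero 2 (norm_ne_zero_iff.2 hx)
  have h := (hasDerivAt_inv hx').comp_hasFDerivAt x (hasFDerivAt_id x).norm_sq
  refine h.congr_fderiv ?_
  ext v
  simp
  ring

theorem hasFDerivAt_shear (s : ℝ) (u : E m) {x : E m} (hx : x ≠ 0) :
    HasFDerivAt (fun x => shear (s * (‖x‖ ^ 2)⁻¹) x u)
      (-((s * (‖x‖ ^ 2)⁻¹) • innerSL ℝ u -
          (2 * s * inner ℝ x u * ((‖x‖ ^ 2)⁻¹) ^ 2) • innerSL ℝ x).smulRight x -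
        (s * (‖x‖ ^ 2)⁻¹ * inner ℝ x u) • ContinuousLinearMap.id ℝ (E m)) x := by
  have h1 : HasFDerivAt (fun x : E m => inner ℝ x u) (innerSL ℝ u) x := by
    simpa [real_inner_comm] using (innerSL ℝ u).hasFDerivAt (x := x)
  have h2 := (((hasFDerivAt_inv_norm_sq hx).const_mul s).mul h1).smul (hasFDerivAt_id x)
  refine (h2.const_sub u).congr_fderiv ?_
  ext v
  simp
  ring

theorem contDiffOn_shear (s : ℝ) (u : E m) {n : WithTop ℕ∞} :
    ContDiffOn ℝ n (fun x => shear (s * (‖x‖ ^ 2)⁻¹) x u) {0}ᶜ := by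
  unfold shear
  refine contDiffOn_const.sub (ContDiffOn.fun_smul (ContDiffOn.mul (contDiffOn_const.mul ?_) ?_)
    contDiffOn_id)
  · exact (contDiff_norm_sq ℝ).contDiffOn.inv fun x hx => pow_ne_zero 2 (norm_ne_zero_iff.2 hx)
  · exact (contDiff_id.inner ℝ contDiff_const).contDiffOn

/-- The divergence of the field with components `⟨x, u⟩ ∂ᵢp(w)`, `w = u - s ⟨x, u⟩ x / |x|²`. -/
theorem divergence_inner_smul_fderiv_shear (hp : p ∈ monogenicPoly m k) (s : ℝ) (u : E m) {x : E m}
    (hx : x ≠ 0) :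
    divergence (fun i x => (inner ℝ x u : ℝ) •
        fderiv ℝ p (shear (s * (‖x‖ ^ 2)⁻¹) x u) (e m i)) x =
      (k : ℝ) • p (shear (s * (‖x‖ ^ 2)⁻¹) x u) +
        ((2 - k) * s * (inner ℝ x u * (‖x‖ ^ 2)⁻¹)) •
          fderiv ℝ p (shear (s * (‖x‖ ^ 2)⁻¹) x u) x -
        ((s ^ 2 - 2 * s) * (inner ℝ x u * (‖x‖ ^ 2)⁻¹) ^ 2) •
          fderiv ℝ (fderiv ℝ p) (shear (s * (‖x‖ ^ 2)⁻¹) x u) x x := by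
  set c : ℝ := inner ℝ x u with hc
  set ρ : ℝ := (‖x‖ ^ 2)⁻¹ with hρ
  set w := shear (s * ρ) x u with hw
  have h1 : HasFDerivAt (fun x : E m => inner ℝ x u) (innerSL ℝ u) x := by
    simpa [real_inner_comm] using (innerSL ℝ u).hasFDerivAt (x := x)
  have hu : u = w + (s * ρ * c) • x := by rw [hw, shear]; abel
  have hd : ∀ i, fderiv ℝ (fun x => (inner ℝ x u : ℝ) •
      fderiv ℝ p (shear (s * (‖x‖ ^ 2)⁻¹) x u) (e m i)) x (e m i) =
      u i • fderiv ℝ p w (e m i) - (s * ρ * c) • (u i • fderiv ℝ (fderiv ℝ p) w x (e m i))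
        + (2 * s * c ^ 2 * ρ ^ 2) • (x i • fderiv ℝ (fderiv ℝ p) w x (e m i))
        - (s * ρ * c ^ 2) • fderiv ℝ (fderiv ℝ p) w (e m i) (e m i) := by
    intro i
    have h2 := ((hp.1.hasFDerivAt_fderiv w).comp x (hasFDerivAt_shear s u hx)).clm_apply
      (hasFDerivAt_const (e m i) x)
    have h3 := h1.smul h2
    have h4 : fderiv ℝ (fun x => (inner ℝ x u : ℝ) •
      fderiv ℝ p (shear (s * (‖x‖ ^ 2)⁻¹) x u) (e m i)) x = _ := h3.fderiv
    rw [h4]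
    simp only [← hw, ← hc, ← hρ, add_apply, smul_apply, ContinuousLinearMap.smulRight_apply,
      ContinuousLinearMap.comp_apply, sub_apply, neg_apply, map_sub, map_neg, map_smul,
      innerSL_apply_apply, EuclideanSpace.inner_single_right, ContinuousLinearMap.id_apply,
      ContinuousLinearMap.flip_apply, Function.comp_apply]
    simp
    module
  rw [divergence, Finset.sum_congr rfl fun i _ => hd i]
  simp only [Finset.sum_sub_distrib, Finset.sum_add_distrib, ← Finset.smul_sum, sum_smul_apply_basis,
    sum_fderiv_fderiv_eq_zero hp]
  have e1 : fderiv ℝ p w u = (k : ℝ) • p w + (s * ρ * c) • fderiv ℝ p w x := by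
    conv_lhs => rw [hu]
    rw [map_add, map_smul, hp.1.euler]
  have e2 : fderiv ℝ (fderiv ℝ p) w x u = ((k : ℝ) - 1) • fderiv ℝ p w x +
      (s * ρ * c) • fderiv ℝ (fderiv ℝ p) w x x := by
    conv_lhs => rw [hu]
    rw [map_add, map_smul, hp.1.euler_fderiv]
  rw [e1, e2]
  module

theorem continuous_shear : Continuous fun z : ℝ × E m × E m => shear z.1 z.2.1 z.2.2 := by
  unfold shear
  fun_prop

theorem continuous_shear_comp {X : Type*} [TopologicalSpace X] {s : X → ℝ} {x u : X → E m}
    (hs : Continuous s) (hx : Continuous x) (hu : Continuous u) :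
    Continuous fun z => shear (s z) (x z) (u z) :=
  continuous_shear.comp (hs.prodMk (hx.prodMk hu))

/-- The divergence theorem for the field `⟨x, u⟩ ∇p(w)`, homogeneous of degree one. -/
theorem integral_inner_smul_fderiv_shear (hm : 0 < m) (hp : p ∈ monogenicPoly m k) (s : ℝ)
    (u : E m) :
    (m : ℝ) • ∫ t : sphere (0 : E m) 1, (inner ℝ (t : E m) u : ℝ) • fderiv ℝ p (shear s t u) t
        ∂sphereMeasure m =
      ∫ t : sphere (0 : E m) 1, ((k : ℝ) • p (shear s t u) +
        ((2 - k) * s * inner ℝ (t : E m) u) • fderiv ℝ p (shear s t u) t -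
        ((s ^ 2 - 2 * s) * (inner ℝ (t : E m) u) ^ 2) •
          fderiv ℝ (fderiv ℝ p) (shear s t u) t t) ∂sphereMeasure m := by
  -- Both sides scale by powers of the radius, so comparing any two radii gives the identity.
  have hflux := flux_sub_flux_eq_integral_divergence (R := 3) (a := 1) (b := 2) hm
    (F := fun i x => (inner ℝ x u : ℝ) • fderiv ℝ p (shear (s * (‖x‖ ^ 2)⁻¹) x u) (e m i)) ?_
    ⟨by norm_num, by norm_num⟩ ⟨by norm_num, by norm_num⟩
  · have hF : ∀ r : ℝ, 0 < r → ∀ t : sphere (0 : E m) 1, (∑ i, (t : E m) i •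
        ((inner ℝ (r • (t : E m)) u : ℝ) • fderiv ℝ p
          (shear (s * (‖r • (t : E m)‖ ^ 2)⁻¹) (r • (t : E m)) u) (e m i))) =
        r • (inner ℝ (t : E m) u : ℝ) • fderiv ℝ p (shear s t u) t := by
      intro r hr t
      rw [shear_smul hr.ne' (norm_eq_of_mem_sphere t)]
      simp only [smul_comm _ (inner ℝ (r • (t : E m)) u : ℝ), ← Finset.smul_sum, sum_smul_apply_basis]
      rw [inner_smul_left, mul_smul]
      simp
    have hdiv : ∀ r : ℝ, 0 < r → ∀ t : sphere (0 : E m) 1,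
        divergence (fun i x => (inner ℝ x u : ℝ) •
          fderiv ℝ p (shear (s * (‖x‖ ^ 2)⁻¹) x u) (e m i)) (r • (t : E m)) =
        (k : ℝ) • p (shear s t u) +
          ((2 - k) * s * inner ℝ (t : E m) u) • fderiv ℝ p (shear s t u) t -
          ((s ^ 2 - 2 * s) * (inner ℝ (t : E m) u) ^ 2) •
          fderiv ℝ (fderiv ℝ p) (shear s t u) t t := by
      intro r hr t
      have ht : ‖(t : E m)‖ = 1 := norm_eq_of_mem_sphere t
      rw [divergence_inner_smul_fderiv_shear hp s u, shear_smul hr.ne' ht]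
      · have : ‖r • (t : E m)‖ ^ 2 = r ^ 2 := by
          rw [norm_smul, ht, mul_one, Real.norm_eq_abs, sq_abs]
        rw [this, inner_smul_left]
        simp only [map_smul, smul_apply, smul_smul]
        simp only [conj_trivial]
        congr 2
        · congr 1
          field_simp
        · field_simp
      · rw [← norm_ne_zero_iff, norm_smul, ht]
        simp [hr.ne']
    rw [intervalIntegral.integral_congr (g := fun a => a ^ (m - 1) • ∫ t : sphere (0 : E m) 1,
        ((k : ℝ) • p (shear s t u) +
          ((2 - k) * s * inner ℝ (t : E m) u) • fderiv ℝ p (shear s t u) t -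
          ((s ^ 2 - 2 * s) * (inner ℝ (t : E m) u) ^ 2) •
          fderiv ℝ (fderiv ℝ p) (shear s t u) t t) ∂sphereMeasure m)] at hflux
    · simp only [hF 1 one_pos, hF 2 two_pos] at hflux
      rw [integral_smul, intervalIntegral.integral_smul_const, integral_pow, integral_smul,
        smul_smul, smul_smul, ← sub_smul] at hflux
      obtain ⟨n, rfl⟩ : ∃ n, m = n + 1 := ⟨m - 1, by omega⟩
      have h2 : (0 : ℝ) < 2 ^ (n + 1) - 1 := by
        have : (1 : ℝ) < 2 ^ (n + 1) := one_lt_pow₀ one_lt_two (Nat.succ_ne_zero n)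
        linarith
      simp only [Nat.add_sub_cancel, one_pow, mul_one] at hflux
      rw [← pow_succ, div_eq_mul_inv, mul_smul] at hflux
      have h3 := smul_right_injective _ h2.ne' hflux
      have h4 : ((n : ℝ) + 1) ≠ 0 := by positivity
      rw [h3, smul_smul]
      push_cast
      rw [mul_inv_cancel₀ h4, one_smul]
    · intro a ha
      rw [uIcc_of_le one_le_two] at ha
      have ha0 : 0 < a := by linarith [ha.1]
      simp only [hdiv a ha0]
  · intro i
    refine ContDiffOn.smul (contDiff_id.inner ℝ contDiff_const).contDiffOn ?_
    refine ContDiffOn.clm_apply ?_ contDiffOn_const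
    exact (hp.1.contDiff.fderiv_right (m := 1) (n := 2) le_rfl).comp_contDiffOn
      ((contDiffOn_shear s u).mono fun x hx => hx.2)

theorem hasDerivAt_shear (s : ℝ) (t u : E m) :
    HasDerivAt (fun s => shear s t u) (-((inner ℝ t u : ℝ) • t)) s := by
  have h := (((hasDerivAt_id s).mul_const (inner ℝ t u : ℝ)).smul_const t).const_sub u
  rw [one_mul] at h
  exact h

/-- The integrand of `(s² - 2s) φ'(s) + (2 - m - k s) φ(s)`, where `φ(s)` is the integral of
`p (u - s ⟨t, u⟩ t)` over the unit sphere. -/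
def firstIntegral (m k : ℕ) (p : E m → Cl m) (u : E m) (s : ℝ) (t : sphere (0 : E m) 1) : Cl m :=
  (2 - m - k * s : ℝ) • p (shear s t u) -
    ((s ^ 2 - 2 * s) * inner ℝ (t : E m) u : ℝ) • fderiv ℝ p (shear s t u) t

/-- The derivative of `firstIntegral` in `s`, arranged as the difference of the two integrands in
`integral_inner_smul_fderiv_shear`. -/
def firstIntegralDeriv (m k : ℕ) (p : E m → Cl m) (u : E m) (s : ℝ) (t : sphere (0 : E m) 1) :
    Cl m :=
  (m : ℝ) • ((inner ℝ (t : E m) u : ℝ) • fderiv ℝ p (shear s t u) t) -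
    ((k : ℝ) • p (shear s t u) +
      ((2 - k) * s * inner ℝ (t : E m) u : ℝ) • fderiv ℝ p (shear s t u) t -
      ((s ^ 2 - 2 * s) * (inner ℝ (t : E m) u) ^ 2 : ℝ) •
        fderiv ℝ (fderiv ℝ p) (shear s t u) t t)

theorem hasDerivAt_firstIntegral (hp : p ∈ monogenicPoly m k) (u : E m) (s : ℝ)
    (t : sphere (0 : E m) 1) :
    HasDerivAt (fun s => firstIntegral m k p u s t) (firstIntegralDeriv m k p u s t) s := by
  have h1 := hasDerivAt_shear s (t : E m) u
  have h2 := (hp.1.differentiable _).hasFDerivAt.comp_hasDerivAt s h1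
  have h3 := ((hp.1.hasFDerivAt_fderiv _).comp_hasDerivAt s h1).clm_apply
    (hasDerivAt_const s (t : E m))
  have h4 : HasDerivAt (fun s : ℝ => 2 - (m : ℝ) - k * s) (-k) s := by
    simpa using ((hasDerivAt_id s).const_mul (k : ℝ)).const_sub (2 - (m : ℝ))
  have h5 : HasDerivAt (fun s : ℝ => (s ^ 2 - 2 * s) * inner ℝ (t : E m) u)
      ((2 * s - 2) * inner ℝ (t : E m) u) s := by
    refine HasDerivAt.mul_const ?_ _
    refine ((hasDerivAt_pow 2 s).sub ((hasDerivAt_id s).const_mul (2 : ℝ))).congr_deriv ?_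
    simp
  refine ((h4.smul h2).sub (h5.smul h3)).congr_deriv ?_
  simp only [firstIntegralDeriv, Function.comp_apply, map_neg, map_smul, neg_apply, smul_apply,
    map_zero, add_zero]
  module

section Continuity
variable {X : Type*} [TopologicalSpace X] {s : X → ℝ} {t : X → sphere (0 : E m) 1}

theorem continuous_comp_shear (hp : p ∈ monogenicPoly m k) (u : E m) (hs : Continuous s)
    (ht : Continuous t) : Continuous fun z => p (shear (s z) (t z) u) :=
  hp.1.differentiable.continuous.comp
    (continuous_shear_comp hs (continuous_subtype_val.comp ht) continuous_const)

theorem continuous_fderiv_shear (hp : p ∈ monogenicPoly m k) (u : E m) {v : X → E m}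
    (hs : Continuous s) (ht : Continuous t) (hv : Continuous v) :
    Continuous fun z => fderiv ℝ p (shear (s z) (t z) u) (v z) :=
  (hp.1.continuous_fderiv.comp
    (continuous_shear_comp hs (continuous_subtype_val.comp ht) continuous_const)).clm_apply hv

theorem continuous_fderiv_fderiv_shear (hp : p ∈ monogenicPoly m k) (u : E m) {v : X → E m}
    (hs : Continuous s) (ht : Continuous t) (hv : Continuous v) :
    Continuous fun z => fderiv ℝ (fderiv ℝ p) (shear (s z) (t z) u) (v z) (v z) :=
  ((hp.1.continuous_fderiv_fderiv.comp (continuous_shear_comp hs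
    (continuous_subtype_val.comp ht) continuous_const)).clm_apply hv).clm_apply hv

theorem continuous_firstIntegral (hp : p ∈ monogenicPoly m k) (u : E m) (hs : Continuous s)
    (ht : Continuous t) : Continuous fun z => firstIntegral m k p u (s z) (t z) := by
  have htv : Continuous fun z => (t z : E m) := continuous_subtype_val.comp ht
  have hi : Continuous fun z => (inner ℝ (t z : E m) u : ℝ) := htv.inner continuous_const
  have c1 : Continuous fun z => (2 - m - k * s z : ℝ) := by fun_prop
  have c2 : Continuous fun z => ((s z ^ 2 - 2 * s z) * inner ℝ (t z : E m) u : ℝ) :=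
    Continuous.mul (by fun_prop) hi
  exact (c1.fun_smul (continuous_comp_shear hp u hs ht)).fun_sub
    (c2.fun_smul (continuous_fderiv_shear hp u hs ht htv))

theorem continuous_firstIntegralDeriv (hp : p ∈ monogenicPoly m k) (u : E m) (hs : Continuous s)
    (ht : Continuous t) : Continuous fun z => firstIntegralDeriv m k p u (s z) (t z) := by
  have htv : Continuous fun z => (t z : E m) := continuous_subtype_val.comp ht
  have hi : Continuous fun z => (inner ℝ (t z : E m) u : ℝ) := htv.inner continuous_const
  have h1 := continuous_fderiv_shear hp u hs ht htv
  have c1 : Continuous fun z => ((2 - k) * s z * inner ℝ (t z : E m) u : ℝ) :=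
    (continuous_const.mul hs).mul hi
  have c2 : Continuous fun z => ((s z ^ 2 - 2 * s z) * (inner ℝ (t z : E m) u) ^ 2 : ℝ) :=
    Continuous.mul (by fun_prop) (hi.pow 2)
  exact ((hi.fun_smul h1).fun_const_smul (m : ℝ)).fun_sub
    ((((continuous_comp_shear hp u hs ht).fun_const_smul (k : ℝ)).fun_add (c1.fun_smul h1)).fun_sub
      (c2.fun_smul (continuous_fderiv_fderiv_shear hp u hs ht htv)))

end Continuity

theorem integral_firstIntegralDeriv (hm : 0 < m) (hp : p ∈ monogenicPoly m k) (u : E m) (s : ℝ) :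
    ∫ t, firstIntegralDeriv m k p u s t ∂sphereMeasure m = 0 := by
  have hs : Continuous fun _ : sphere (0 : E m) 1 => s := continuous_const
  have hi : Continuous fun t : sphere (0 : E m) 1 => (inner ℝ (t : E m) u : ℝ) :=
    continuous_subtype_val.inner continuous_const
  have h1 := continuous_fderiv_shear hp u hs continuous_id continuous_subtype_val
  have h2 : Continuous fun t : sphere (0 : E m) 1 =>
      (m : ℝ) • ((inner ℝ (t : E m) u : ℝ) • fderiv ℝ p (shear s t u) t) :=
    (hi.fun_smul h1).fun_const_smul _
  have h3 := continuous_firstIntegralDeriv hp u hs continuous_id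
  have h4 := h2.fun_sub h3
  simp only [firstIntegralDeriv, id_eq] at h4
  simp only [sub_sub_cancel] at h4
  simp only [firstIntegralDeriv]
  rw [integral_sub (integrable_sphere h2) (integrable_sphere h4), integral_smul,
    integral_inner_smul_fderiv_shear hm hp s u]
  exact sub_self _

/-- The spherical mean of `p` over the reflections of `u` is `c_k p(u)`: the integral of
`firstIntegral` takes the same value at `s = 2` and at `s = 0`. -/
theorem integral_comp_reflection (hm : 3 ≤ m) (hp : p ∈ monogenicPoly m k) (u : E m) :
    ∫ t : sphere (0 : E m) 1, p (shear 2 t u) ∂sphereMeasure m =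
      (sphereArea m * cConst m k) • p u := by
  have hconst : ∫ t, firstIntegral m k p u 2 t ∂sphereMeasure m =
      ∫ t, firstIntegral m k p u 0 t ∂sphereMeasure m := by
    have hD : ∀ s, HasDerivAt (fun s => ∫ t, firstIntegral m k p u s t ∂sphereMeasure m) 0 s :=
      fun s => by
        rw [← integral_firstIntegralDeriv (by omega) hp u s]
        exact hasDerivAt_integral_sphere (hasDerivAt_firstIntegral hp u)
          (fun s => continuous_firstIntegral hp u continuous_const continuous_id)
          (continuous_firstIntegralDeriv hp u continuous_fst continuous_snd) s
    exact is_const_of_deriv_eq_zero (fun s => (hD s).differentiableAt) (fun s => (hD s).deriv) 2 0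
  have h2 : ∀ t, firstIntegral m k p u 2 t = (2 - m - k * 2 : ℝ) • p (shear 2 t u) := fun t => by
    unfold firstIntegral
    norm_num
  have h0 : ∀ t, firstIntegral m k p u 0 t = (2 - m : ℝ) • p u := fun t => by
    simp [firstIntegral, shear]
  simp only [h2, h0] at hconst
  rw [integral_smul, integral_const] at hconst
  have hm' : (3 : ℝ) ≤ m := by exact_mod_cast hm
  have hk : (0 : ℝ) ≤ k := k.cast_nonneg
  have hN : (2 - m - k * 2 : ℝ) ≠ 0 := by
    intro h
    linarith
  have hN' : (m + 2 * k - 2 : ℝ) ≠ 0 := fun h => hN (by linarith)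
  apply smul_right_injective _ hN
  simp only
  rw [hconst, smul_smul, smul_smul, sphereArea, cConst]
  congr 1
  field_simp
  ring

end SphericalMean

/-! ### The divergence-free fields attached to the fundamental solution -/

section Field
variable {m k : ℕ} {p : E m → Cl m}

theorem fischerProj_congr {h₁ h₂ : E m → Cl m} {u : E m} (h : h₁ =ᶠ[nhds u] h₂) :
    fischerProj m k h₁ u = fischerProj m k h₂ u := by
  simp only [fischerProj, dirac, h.eq_of_nhds, h.fderiv_eq]

theorem fischerProj_sum_smul {ι : Type*} (s : Finset ι) (c : ι → ℝ) {h : ι → E m → Cl m} {u : E m}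
    (hh : ∀ j, DifferentiableAt ℝ (h j) u) :
    fischerProj m k (fun w => ∑ j ∈ s, c j • h j w) u = ∑ j ∈ s, c j • fischerProj m k (h j) u := by
  have h1 : HasFDerivAt (fun w => ∑ j ∈ s, c j • h j w) (∑ j ∈ s, c j • fderiv ℝ (h j) u) u :=
    HasFDerivAt.fun_sum fun j _ => (hh j).hasFDerivAt.const_smul (c j)
  simp only [fischerProj, dirac, h1.fderiv, sum_apply, smul_apply,
    Finset.mul_sum, mul_smul_comm, smul_add, Finset.sum_add_distrib, Finset.smul_sum]
  congr 1
  rw [Finset.sum_comm]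
  refine Finset.sum_congr rfl fun j _ => Finset.sum_congr rfl fun i _ => ?_
  rw [smul_comm]

theorem sum_smul_mul_vec_mul (a b : Cl m) (x : E m) :
    ∑ i, x i • (a * (vec m (e m i) * b)) = a * (vec m x * b) := by
  rw [← sum_smul_vec x, Finset.sum_mul, Finset.mul_sum]
  simp only [smul_mul_assoc, mul_smul_comm]

theorem sum_smul_vec_mul (b : Cl m) (x : E m) :
    ∑ i, x i • (vec m (e m i) * b) = vec m x * b := by
  simpa using sum_smul_mul_vec_mul 1 b x

theorem shear_single (s : ℝ) (x : E m) (i : Fin m) :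
    shear s x (e m i) = e m i - (s * x i) • x := by
  simp [shear, EuclideanSpace.inner_single_right]

theorem sum_vec_mul_fderiv_shear (hp : p ∈ monogenicPoly m k) (s : ℝ) (x w : E m) :
    ∑ i, vec m (e m i) * fderiv ℝ p w (shear s x (e m i)) =
      -(s • (vec m x * fderiv ℝ p w x)) := by
  have h0 : ∑ i, vec m (e m i) * fderiv ℝ p w (e m i) = 0 := hp.2 w
  simp only [shear_single, map_sub, map_smul, mul_sub, mul_smul_comm, mul_smul,
    Finset.sum_sub_distrib, h0, ← Finset.smul_sum, sum_smul_vec_mul, zero_sub]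

theorem hasFDerivAt_shear_right (s : ℝ) (x u : E m) :
    HasFDerivAt (shear s x)
      (ContinuousLinearMap.id ℝ (E m) - (s • innerSL ℝ x).smulRight x) u := by
  have h1 : HasFDerivAt (fun u : E m => inner ℝ x u) (innerSL ℝ x) u :=
    (innerSL ℝ x).hasFDerivAt
  exact (hasFDerivAt_id u).sub ((h1.const_mul s).smul_const x)

theorem fderiv_comp_shear_right (hp : p ∈ monogenicPoly m k) (s : ℝ) (x u v : E m) :
    fderiv ℝ (fun w => p (shear s x w)) u v = fderiv ℝ p (shear s x u) (shear s x v) := by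
  have h := (hp.1.differentiable (shear s x u)).hasFDerivAt.comp u (hasFDerivAt_shear_right s x u)
  have h' : fderiv ℝ (fun w => p (shear s x w)) u = _ := h.fderiv
  rw [h']
  simp [shear]

theorem differentiable_comp_shear (hp : p ∈ monogenicPoly m k) (s : ℝ) (x : E m) :
    Differentiable ℝ (fun w => p (shear s x w)) := fun u =>
  ((hp.1.differentiable (shear s x u)).hasFDerivAt.comp u
    (hasFDerivAt_shear_right s x u)).differentiableAt

/-- The projection `P_k` of `u ↦ p (u - s ⟨x, u⟩ x)`. -/
theorem fischerProj_comp_shear (hp : p ∈ monogenicPoly m k) (s : ℝ) (x u : E m) :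
    fischerProj m k (fun w => p (shear s x w)) u = p (shear s x u) -
      (((m : ℝ) + 2 * k - 2)⁻¹ * s) • (vec m u * (vec m x * fderiv ℝ p (shear s x u) x)) := by
  simp only [fischerProj, dirac, fderiv_comp_shear_right hp, sum_vec_mul_fderiv_shear hp, mul_neg,
    mul_smul_comm, smul_neg, smul_smul]
  abel

theorem continuous_fischerProj_comp_shear (hp : p ∈ monogenicPoly m k) (s : ℝ) (u : E m) :
    Continuous fun t : sphere (0 : E m) 1 => fischerProj m k (fun w => p (shear s t w)) u := by
  simp only [fischerProj_comp_shear hp]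
  refine (continuous_comp_shear hp u continuous_const continuous_id).fun_sub
    (Continuous.fun_const_smul ?_ _)
  exact continuous_cl_mul continuous_const (continuous_cl_mul
    (continuous_vec.comp continuous_subtype_val)
    (continuous_fderiv_shear hp u continuous_const continuous_id continuous_subtype_val))

theorem integral_const_mul_sphere (a : Cl m) {g : sphere (0 : E m) 1 → Cl m} (hg : Continuous g) :
    ∫ t, a * g t ∂sphereMeasure m = a * ∫ t, g t ∂sphereMeasure m :=
  (mulCLM m a).integral_comp_comm (integrable_sphere hg)

/-- The derivative in `u`, in the direction `v`, of `integral_comp_reflection`. -/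
theorem integral_fderiv_comp_reflection (hm : 3 ≤ m) (hp : p ∈ monogenicPoly m k) (u v : E m) :
    ∫ t : sphere (0 : E m) 1, fderiv ℝ p (shear 2 t u) (shear 2 t v) ∂sphereMeasure m =
      (sphereArea m * cConst m k) • fderiv ℝ p u v := by
  have hline : ∀ a : ℝ, HasDerivAt (fun a : ℝ => u + a • v) v a := fun a => by
    simpa using ((hasDerivAt_id a).smul_const v).const_add u
  have hc : Continuous fun z : ℝ × sphere (0 : E m) 1 => shear 2 (z.2 : E m) (u + z.1 • v) :=
    continuous_shear_comp continuous_const (by fun_prop) (by fun_prop)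
  have hcv : Continuous fun z : ℝ × sphere (0 : E m) 1 => shear 2 (z.2 : E m) v :=
    continuous_shear_comp continuous_const (by fun_prop) continuous_const
  have h1 := hasDerivAt_integral_sphere (m := m)
    (g := fun a t => p (shear 2 (t : E m) (u + a • v)))
    (g' := fun a t => fderiv ℝ p (shear 2 (t : E m) (u + a • v)) (shear 2 (t : E m) v)) ?_ ?_ ?_ 0
  · simp only [integral_comp_reflection hm hp, zero_smul, add_zero] at h1
    have h2 := ((hp.1.differentiable (u + (0 : ℝ) • v)).hasFDerivAt.comp_hasDerivAt (0 : ℝ)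
      (hline 0)).const_smul (sphereArea m * cConst m k)
    simp only [zero_smul, add_zero] at h2
    exact h1.unique h2
  · intro a t
    have h3 := ((differentiable_comp_shear hp 2 (t : E m)) (u + a • v)).hasFDerivAt.comp_hasDerivAt
      a (hline a)
    rw [fderiv_comp_shear_right hp] at h3
    exact h3
  · intro a
    exact hp.1.differentiable.continuous.comp (hc.comp (continuous_const.prodMk continuous_id))
  · exact (hp.1.continuous_fderiv.comp hc).clm_apply hcv

/-- The spherical mean of `P_k p(t u t̃)` is `c_k p(u)`. -/
theorem integral_fischerProj_comp_reflection (hm : 3 ≤ m) (hp : p ∈ monogenicPoly m k) (u : E m) :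
    ∫ t : sphere (0 : E m) 1, fischerProj m k (fun w => p (shear 2 t w)) u ∂sphereMeasure m =
      (sphereArea m * cConst m k) • p u := by
  have hcf : ∀ v : sphere (0 : E m) 1 → E m, Continuous v →
      Continuous fun t : sphere (0 : E m) 1 => fderiv ℝ p (shear 2 (t : E m) u) (v t) := fun v hv =>
    continuous_fderiv_shear hp u continuous_const continuous_id hv
  have hcx : Continuous fun t : sphere (0 : E m) 1 =>
      vec m t * fderiv ℝ p (shear 2 (t : E m) u) t :=
    continuous_cl_mul (continuous_vec.comp continuous_subtype_val) (hcf _ continuous_subtype_val)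
  -- Up to the factor `-2`, this is `D_u` of the spherical mean of `p(t u t̃)`, a multiple of `D p`.
  have h0 : ∫ t : sphere (0 : E m) 1, vec m t * fderiv ℝ p (shear 2 t u) t ∂sphereMeasure m = 0 := by
    have h1 : ∑ i, vec m (e m i) * ((sphereArea m * cConst m k) • fderiv ℝ p u (e m i)) = 0 := by
      simp only [mul_smul_comm, ← Finset.smul_sum]
      rw [show ∑ i, vec m (e m i) * fderiv ℝ p u (e m i) = 0 from hp.2 u, smul_zero]
    have hci : ∀ i, Continuous fun t : sphere (0 : E m) 1 =>
        fderiv ℝ p (shear 2 (t : E m) u) (shear 2 (t : E m) (e m i)) := fun i =>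
      hcf _ (continuous_shear_comp continuous_const continuous_subtype_val continuous_const)
    simp only [← integral_fderiv_comp_reflection hm hp] at h1
    simp only [← integral_const_mul_sphere _ (hci _)] at h1
    rw [← integral_finsetSum _ fun i _ =>
      integrable_sphere (continuous_cl_mul continuous_const (hci i))] at h1
    simp only [sum_vec_mul_fderiv_shear hp] at h1
    rw [integral_neg, neg_eq_zero, integral_smul] at h1
    exact (smul_eq_zero.1 h1).resolve_left two_ne_zero
  simp only [fischerProj_comp_shear hp]
  rw [integral_sub, integral_smul, integral_const_mul_sphere _ hcx]
  · rw [h0, mul_zero, smul_zero, sub_zero, integral_comp_reflection hm hp]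
  · exact integrable_sphere (continuous_comp_shear hp u continuous_const continuous_id)
  · exact integrable_sphere ((continuous_cl_mul continuous_const hcx).fun_const_smul _)

/-- The components `|x|^{-m} x P_{k,w}(e_i p)(w)` at `w = x u x̃ / |x|²`, rewritten with
`x w = -u x`: the fundamental solution of the Rarita-Schwinger operator, paired with `e_i p`. -/
def cauchyField (m k : ℕ) (p : E m → Cl m) (u : E m) (i : Fin m) (x : E m) : Cl m :=
  (‖x‖ ^ m)⁻¹ • (vec m x * (vec m (e m i) * p (shear (2 * (‖x‖ ^ 2)⁻¹) x u)) +
    (2 * ((m : ℝ) + 2 * k - 2)⁻¹) •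
      (vec m u * (vec m x * fderiv ℝ p (shear (2 * (‖x‖ ^ 2)⁻¹) x u) (e m i))))

theorem hasFDerivAt_inv_norm_pow {x : E m} (hx : x ≠ 0) :
    HasFDerivAt (fun x : E m => (‖x‖ ^ m)⁻¹)
      (-(m * (‖x‖ ^ 2)⁻¹ * (‖x‖ ^ m)⁻¹) • innerSL ℝ x) x := by
  have hx' : ‖x‖ ≠ 0 := norm_ne_zero_iff.2 hx
  have h1 : HasDerivAt (fun s : ℝ => (s ^ m)⁻¹) (-(m * ‖x‖ ^ (m - 1)) / (‖x‖ ^ m) ^ 2) ‖x‖ := by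
    exact (hasDerivAt_pow m ‖x‖).fun_inv (pow_ne_zero m hx')
  refine (hasFDerivAt_comp_norm hx h1.differentiableAt).congr_fderiv ?_
  rw [h1.deriv]
  congr 1
  rcases m with _ | n
  · simp
  · simp only [Nat.add_sub_cancel]
    field_simp
    ring

theorem hasFDerivAt_vec_mul {g : E m → Cl m} {g' : E m →L[ℝ] Cl m} {x : E m}
    (hg : HasFDerivAt g g' x) :
    HasFDerivAt (fun x => vec m x * g x) ((mulCLM m (vec m x)).comp g' +
      ((mulCLM m).flip (g x)).comp (LinearMap.toContinuousLinearMap (vec m))) x := by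
  have h1 : HasFDerivAt (fun w => vec m w) (LinearMap.toContinuousLinearMap (vec m)) x :=
    (LinearMap.toContinuousLinearMap (vec m)).hasFDerivAt
  refine ((mulCLM m).hasFDerivAt_of_bilinear h1 hg).congr_fderiv ?_
  ext v
  simp

/-- `∑ xᵢ Fᵢ = -|x|^{2-m} P_k p(x u x̃ / |x|²)`. -/
theorem sum_smul_cauchyField (hp : p ∈ monogenicPoly m k) (u : E m) {x : E m} (hx : x ≠ 0) :
    ∑ i, x i • cauchyField m k p u i x =
      -((‖x‖ ^ m)⁻¹ * ‖x‖ ^ 2) •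
        fischerProj m k (fun w => p (shear (2 * (‖x‖ ^ 2)⁻¹) x w)) u := by
  have hx' : ‖x‖ ^ 2 ≠ 0 := pow_ne_zero 2 (norm_ne_zero_iff.2 hx)
  set w := shear (2 * (‖x‖ ^ 2)⁻¹) x u with hw
  have h1 : ∑ i, x i • (vec m u * (vec m x * fderiv ℝ p w (e m i))) =
      vec m u * (vec m x * fderiv ℝ p w x) := by
    rw [← sum_smul_apply_basis (fderiv ℝ p w) x]
    simp only [Finset.mul_sum, mul_smul_comm]
  simp only [cauchyField, ← hw, smul_comm (x _) (‖x‖ ^ m)⁻¹, ← Finset.smul_sum, smul_add,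
    Finset.sum_add_distrib, sum_smul_mul_vec_mul,
    smul_comm (x _) (2 * ((m : ℝ) + 2 * k - 2)⁻¹), h1, vec_mul_self_mul,
    fischerProj_comp_shear hp]
  rw [smul_sub, smul_smul, smul_smul]
  match_scalars
  · ring
  · field_simp

theorem contDiffOn_cauchyField (hp : p ∈ monogenicPoly m k) (u : E m) (i : Fin m) :
    ContDiffOn ℝ 1 (cauchyField m k p u i) {0}ᶜ := by
  have hbil : ∀ {g h : E m → Cl m}, ContDiffOn ℝ 1 g {0}ᶜ → ContDiffOn ℝ 1 h {0}ᶜ →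
      ContDiffOn ℝ 1 (fun x => g x * h x) {0}ᶜ := fun hg hh =>
    ((mulCLM m).contDiff.comp_contDiffOn hg).clm_apply hh
  have hvec : ContDiffOn ℝ 1 (fun x => vec m x) {0}ᶜ :=
    (LinearMap.toContinuousLinearMap (vec m)).contDiff.contDiffOn
  have hs := contDiffOn_shear (m := m) 2 u (n := 1)
  have h0 : ContDiffOn ℝ 1 (fun x => p (shear (2 * (‖x‖ ^ 2)⁻¹) x u)) {0}ᶜ :=
    (hp.1.contDiff (n := 1)).comp_contDiffOn hs
  have h1 : ContDiffOn ℝ 1 (fun x => fderiv ℝ p (shear (2 * (‖x‖ ^ 2)⁻¹) x u) (e m i)) {0}ᶜ :=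
    ((hp.1.contDiff.fderiv_right (m := 1) (n := 2) le_rfl).comp_contDiffOn hs).clm_apply
      contDiffOn_const
  have h2 : ContDiffOn ℝ 1 (fun x : E m => (‖x‖ ^ m)⁻¹) {0}ᶜ := by
    refine ContDiffOn.inv (fun x hx => ?_) fun x hx => pow_ne_zero m (norm_ne_zero_iff.2 hx)
    exact ((contDiffAt_norm ℝ hx).pow m).contDiffWithinAt
  exact ContDiffOn.fun_smul h2 (ContDiffOn.add (hbil hvec (hbil contDiffOn_const h0))
    (ContDiffOn.fun_smul contDiffOn_const (hbil contDiffOn_const (hbil hvec h1))))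

/-- The terms `∂ᵢFᵢ` of the divergence of `cauchyField`, before summation over `i`. -/
theorem fderiv_cauchyField (hp : p ∈ monogenicPoly m k) (u : E m) (i : Fin m) {x : E m}
    (hx : x ≠ 0) {w : E m} (hw : w = shear (2 * (‖x‖ ^ 2)⁻¹) x u) :
    fderiv ℝ (cauchyField m k p u i) x (e m i) =
      -(m * (‖x‖ ^ 2)⁻¹) • (x i • cauchyField m k p u i x) +
      (‖x‖ ^ m)⁻¹ • (-(p w)
        + (-(2 * (‖x‖ ^ 2)⁻¹) • (u i • (vec m x * (vec m (e m i) * fderiv ℝ p w x)))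
          + (4 * inner ℝ x u * ((‖x‖ ^ 2)⁻¹) ^ 2) •
            (x i • (vec m x * (vec m (e m i) * fderiv ℝ p w x)))
          - (2 * (‖x‖ ^ 2)⁻¹ * inner ℝ x u) • (vec m x * (vec m (e m i) * fderiv ℝ p w (e m i))))
        + (2 * ((m : ℝ) + 2 * k - 2)⁻¹) • (vec m u * (vec m (e m i) * fderiv ℝ p w (e m i)) +
            vec m u * (vec m x * (-(2 * (‖x‖ ^ 2)⁻¹) • (u i • fderiv ℝ (fderiv ℝ p) w x (e m i))
              + (4 * inner ℝ x u * ((‖x‖ ^ 2)⁻¹) ^ 2) • (x i • fderiv ℝ (fderiv ℝ p) w x (e m i))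
              - (2 * (‖x‖ ^ 2)⁻¹ * inner ℝ x u) •
                fderiv ℝ (fderiv ℝ p) w (e m i) (e m i))))) := by
  have hs := hasFDerivAt_shear 2 u hx
  have h0 : HasFDerivAt (fun x => p (shear (2 * (‖x‖ ^ 2)⁻¹) x u)) _ x :=
    (hp.1.differentiable _).hasFDerivAt.comp x hs
  have h1 : HasFDerivAt (fun x => fderiv ℝ p (shear (2 * (‖x‖ ^ 2)⁻¹) x u) (e m i)) _ x :=
    ((hp.1.hasFDerivAt_fderiv _).comp x hs).clm_apply (hasFDerivAt_const (e m i) x)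
  have h2 := hasFDerivAt_vec_mul (hasFDerivAt_const_mul (vec m (e m i)) h0)
  have h3 := hasFDerivAt_const_mul (vec m u) (hasFDerivAt_vec_mul h1)
  have h4 := (hasFDerivAt_inv_norm_pow hx).smul (h2.add (h3.const_smul
    (2 * ((m : ℝ) + 2 * k - 2)⁻¹)))
  have h5 : fderiv ℝ (cauchyField m k p u i) x = _ := h4.fderiv
  have hee : ∀ a : Cl m, vec m (e m i) * (vec m (e m i) * a) = -a := fun a => by
    rw [vec_mul_self_mul]
    simp
  rw [h5]
  simp only [← hw, add_apply, smul_apply, ContinuousLinearMap.smulRight_apply,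
    ContinuousLinearMap.comp_apply, sub_apply, neg_apply, map_sub, map_neg, map_smul,
    innerSL_apply_apply, EuclideanSpace.inner_single_right, ContinuousLinearMap.id_apply,
    ContinuousLinearMap.flip_apply, Function.comp_apply, mulCLM_apply, Pi.add_apply, Pi.smul_apply,
    LinearMap.coe_toContinuousLinearMap', hee, cauchyField, zero_apply, map_zero, mul_zero,
    mul_add, mul_sub, mul_neg, mul_smul_comm]
  simp only [conj_trivial, one_mul]
  module

/-- The field `cauchyField` is divergence-free away from the origin. All terms are multiples of
`u x ⟨x, ∇p⟩`, `⟨x, ∇p⟩` and `p`; the first cancel because the constant in `P_k` is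
`1 / (m + 2k - 2)`. -/
theorem divergence_cauchyField (hm : 3 ≤ m) (hp : p ∈ monogenicPoly m k) (u : E m) {x : E m}
    (hx : x ≠ 0) : divergence (cauchyField m k p u) x = 0 := by
  have hx' : ‖x‖ ^ 2 ≠ 0 := pow_ne_zero 2 (norm_ne_zero_iff.2 hx)
  have hN : (m : ℝ) + 2 * k - 2 ≠ 0 := by
    have : (3 : ℝ) ≤ m := by exact_mod_cast hm
    have : (0 : ℝ) ≤ k := k.cast_nonneg
    intro h
    linarith
  rw [divergence, Finset.sum_congr rfl fun i _ => fderiv_cauchyField hp u i hx rfl]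
  set w := shear (2 * (‖x‖ ^ 2)⁻¹) x u with hw
  set c : ℝ := inner ℝ x u with hc
  have hu : u = w + (2 * (‖x‖ ^ 2)⁻¹ * c) • x := by rw [hw, shear]; abel
  have e2 : fderiv ℝ (fderiv ℝ p) w x u = ((k : ℝ) - 1) • fderiv ℝ p w x +
      (2 * (‖x‖ ^ 2)⁻¹ * c) • fderiv ℝ (fderiv ℝ p) w x x := by
    conv_lhs => rw [hu]
    rw [map_add, map_smul, hp.1.euler_fderiv]
  have s1 : ∑ i, vec m x * (vec m (e m i) * fderiv ℝ p w (e m i)) = 0 := by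
    rw [← Finset.mul_sum, show ∑ i, vec m (e m i) * fderiv ℝ p w (e m i) = 0 from hp.2 w, mul_zero]
  have s2 : ∑ i, vec m u * (vec m (e m i) * fderiv ℝ p w (e m i)) = 0 := by
    rw [← Finset.mul_sum, show ∑ i, vec m (e m i) * fderiv ℝ p w (e m i) = 0 from hp.2 w, mul_zero]
  have s3 : ∑ i, vec m u * (vec m x * (-(2 * (‖x‖ ^ 2)⁻¹) •
      (u i • fderiv ℝ (fderiv ℝ p) w x (e m i))
        + (4 * c * ((‖x‖ ^ 2)⁻¹) ^ 2) • (x i • fderiv ℝ (fderiv ℝ p) w x (e m i))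
        - (2 * (‖x‖ ^ 2)⁻¹ * c) • fderiv ℝ (fderiv ℝ p) w (e m i) (e m i))) =
      -(2 * (‖x‖ ^ 2)⁻¹ * ((k : ℝ) - 1)) • (vec m u * (vec m x * fderiv ℝ p w x)) := by
    simp only [← Finset.mul_sum, Finset.sum_sub_distrib, Finset.sum_add_distrib,
      ← Finset.smul_sum, sum_smul_apply_basis, sum_fderiv_fderiv_eq_zero hp, e2]
    rw [← mul_smul_comm, ← mul_smul_comm]
    congr 2
    module
  have hxu : vec m x * (vec m u * fderiv ℝ p w x) =
      (-2 * c) • fderiv ℝ p w x - vec m u * (vec m x * fderiv ℝ p w x) :=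
    eq_sub_of_add_eq (vec_mul_vec_mul_add_swap x u _)
  simp only [Finset.sum_add_distrib, Finset.sum_sub_distrib, Finset.sum_neg_distrib,
    ← Finset.smul_sum, sum_smul_cauchyField hp u hx, sum_smul_mul_vec_mul, s1, s2, s3, hxu,
    vec_mul_self_mul, fischerProj_comp_shear hp, ← hw, Finset.sum_const, Finset.card_univ,
    Fintype.card_fin, ← Nat.cast_smul_eq_nsmul ℝ]
  match_scalars
  · field_simp
    ring
  · field_simp
    ring
  · field_simp
    ring

end Field

/-! ### Coordinates of functions with values in the monogenic polynomials -/

section Coordinates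
variable {m k : ℕ}

/-- If linear maps on a finite-dimensional space separate points, finitely many of them do. -/
theorem exists_finset_forall_eq_zero {K W V ι : Type*} [DivisionRing K] [AddCommGroup W]
    [Module K W] [FiniteDimensional K W] [AddCommGroup V] [Module K V] (ev : ι → W →ₗ[K] V)
    (h : ∀ v, (∀ i, ev i v = 0) → v = 0) :
    ∃ s : Finset ι, ∀ v, (∀ i ∈ s, ev i v = 0) → v = 0 := by
  classical
  obtain ⟨N, ⟨s, rfl⟩, hs⟩ := IsArtinian.set_has_minimal
    (range fun s : Finset ι => s.inf fun i => (LinearMap.ker (ev i))) (range_nonempty _)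
  have hmem : ∀ (s : Finset ι) v, v ∈ (s.inf fun i => LinearMap.ker (ev i)) ↔
      ∀ i ∈ s, ev i v = 0 := fun s v => by
    simp [Submodule.mem_finsetInf]
  refine ⟨s, fun v hv => h v fun i => ?_⟩
  by_contra hi
  refine hs _ ⟨insert i s, rfl⟩ (lt_of_le_of_ne (Finset.inf_mono (Finset.subset_insert i s)) ?_)
  intro heq
  dsimp only at heq
  have h1 := (hmem s v).2 hv
  rw [← heq] at h1
  exact hi ((hmem _ v).1 h1 i (Finset.mem_insert_self i s))

/-- The real vector space `M_k`. -/
def monogenicSubmodule (m k : ℕ) : Submodule ℝ (E m → Cl m) where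
  carrier := monogenicPoly m k
  add_mem' := by
    rintro p q hp hq
    refine ⟨?_, fun u => ?_⟩
    · obtain ⟨a, ha⟩ := hp.1
      obtain ⟨b, hb⟩ := hq.1
      refine ⟨a + b, fun u => ?_⟩
      simp [ha, hb, smul_add, Finset.sum_add_distrib]
    · have h : fderiv ℝ (p + q) u = fderiv ℝ p u + fderiv ℝ q u :=
        fderiv_add (hp.1.differentiable u) (hq.1.differentiable u)
      have h1 := hp.2 u
      have h2 := hq.2 u
      simp only [dirac] at h1 h2 ⊢
      simp only [h, add_apply, mul_add, Finset.sum_add_distrib, h1, h2, add_zero]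
  zero_mem' := ⟨⟨0, fun u => by simp⟩, fun u => by simp [dirac]⟩
  smul_mem' := by
    rintro c p hp
    refine ⟨?_, fun u => ?_⟩
    · obtain ⟨a, ha⟩ := hp.1
      refine ⟨c • a, fun u => ?_⟩
      simp only [Pi.smul_apply, ha, Finset.smul_sum]
      exact Finset.sum_congr rfl fun i _ => smul_comm _ _ _
    · have h : fderiv ℝ (c • p) u = c • fderiv ℝ p u := fderiv_const_smul (hp.1.differentiable u) c
      have h1 := hp.2 u
      simp only [dirac] at h1 ⊢
      simp only [h, smul_apply, mul_smul_comm, ← Finset.smul_sum, h1, smul_zero]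

instance : FiniteDimensional ℝ (monogenicSubmodule m k) := by
  let L : ((Finset.piAntidiag (Finset.univ : Finset (Fin m)) k) → Cl m) →ₗ[ℝ] (E m → Cl m) :=
    { toFun := fun a u => ∑ α : Finset.piAntidiag (Finset.univ : Finset (Fin m)) k,
        (∏ i, u i ^ α.1 i) • a α
      map_add' := fun a b => by
        funext u
        simp [smul_add, Finset.sum_add_distrib]
      map_smul' := fun c a => by
        funext u
        simp only [Pi.smul_apply, RingHom.id_apply, Finset.smul_sum]
        exact Finset.sum_congr rfl fun i _ => smul_comm _ _ _ }
  refine Submodule.finiteDimensional_of_le (S₂ := LinearMap.range L) fun p hp => ?_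
  obtain ⟨a, ha⟩ := (hp : p ∈ monogenicPoly m k).1
  refine ⟨fun α => a α.1, funext fun u => ?_⟩
  rw [ha]
  exact Finset.sum_coe_sort (Finset.piAntidiag (Finset.univ : Finset (Fin m)) k)
    fun α => (∏ i, u i ^ α i) • a α

theorem eq_zero_of_eqOn_ball {p : E m → Cl m} (hp : IsHomogeneousPoly m k p)
    (h : ∀ w ∈ ball (0 : E m) 1, p w = 0) : p = 0 := by
  funext u
  have hpos : 0 < ‖u‖ + 1 := by positivity
  have h1 := h ((‖u‖ + 1)⁻¹ • u) (by
    rw [mem_ball_zero_iff, norm_smul, norm_inv, Real.norm_of_nonneg hpos.le, inv_mul_lt_one₀ hpos]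
    linarith)
  rw [hp.map_smul] at h1
  exact (smul_eq_zero.1 h1).resolve_left (pow_ne_zero _ (inv_ne_zero hpos.ne'))

/-- Functions with values in `M_k` have coordinates in a basis of `M_k`; the coordinates are linear
combinations of evaluations in the open unit ball, and so inherit the regularity of the function. -/
theorem exists_monogenic_coordinates {Ω : Set (E m)} {f : E m → E m → Cl m}
    (hfM : MonogenicValuedOn m k f (closure Ω))
    (hfC1 : ContDiffOn ℝ 1 (fun z : E m × E m => f z.1 z.2) (Ω ×ˢ ball 0 1))
    (hfC : ContinuousOn (fun z : E m × E m => f z.1 z.2) (closure Ω ×ˢ closedBall 0 1)) :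
    ∃ (n : ℕ) (b : Fin n → E m → Cl m) (c : Fin n → E m → ℝ),
      (∀ j, b j ∈ monogenicPoly m k) ∧ (∀ j, ContDiffOn ℝ 1 (c j) Ω) ∧
      (∀ j, ContinuousOn (c j) (closure Ω)) ∧
      ∀ x ∈ closure Ω, ∀ w ∈ closedBall (0 : E m) 1, f x w = ∑ j, c j x • b j w := by
  let ev : ball (0 : E m) 1 → monogenicSubmodule m k →ₗ[ℝ] Cl m := fun w =>
    (LinearMap.proj (w : E m)).comp (monogenicSubmodule m k).subtype
  obtain ⟨s, hs⟩ := exists_finset_forall_eq_zero ev fun v hv =>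
    Subtype.ext (eq_zero_of_eqOn_ball (Subtype.property v).1 fun w hw => hv ⟨w, hw⟩)
  let A : monogenicSubmodule m k →ₗ[ℝ] (s → Cl m) := LinearMap.pi fun w => ev w.1
  obtain ⟨G, hG⟩ := A.exists_leftInverse_of_injective (LinearMap.ker_eq_bot'.2 fun v hv =>
    hs v fun w hw => congrFun hv ⟨w, hw⟩)
  let B := Module.finBasis ℝ (monogenicSubmodule m k)
  let C : Fin (Module.finrank ℝ (monogenicSubmodule m k)) → (s → Cl m) →L[ℝ] ℝ := fun j =>
    LinearMap.toContinuousLinearMap ((B.coord j).comp G)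
  refine ⟨_, fun j => (B j : E m → Cl m), fun j x => C j fun w => f x w.1, fun j => (B j).2,
    fun j => ?_, fun j => ?_, fun x hx w hw => ?_⟩
  · refine (C j).contDiff.comp_contDiffOn (contDiffOn_pi.2 fun w => ?_)
    exact hfC1.comp (contDiff_id.prodMk contDiff_const).contDiffOn fun x hx => ⟨hx, w.1.2⟩
  · refine (C j).continuous.comp_continuousOn (continuousOn_pi.2 fun w => ?_)
    exact hfC.comp (continuous_id.prodMk continuous_const).continuousOn
      fun x hx => ⟨hx, ball_subset_closedBall w.1.2⟩
  · obtain ⟨p, hp, hfp⟩ := hfM x hx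
    have h1 : (fun w : s => f x w.1) = A ⟨p, hp⟩ := by
      funext w
      exact hfp (ball_subset_closedBall w.1.2)
    have h2 : G (A ⟨p, hp⟩) = ⟨p, hp⟩ := LinearMap.congr_fun hG _
    have h3 := congrArg (fun q : monogenicSubmodule m k => (q : E m → Cl m) w) (B.sum_repr ⟨p, hp⟩)
    simp only [Submodule.coe_sum, Submodule.coe_smul, Finset.sum_apply, Pi.smul_apply] at h3
    rw [hfp hw, ← h3]
    refine Finset.sum_congr rfl fun j _ => ?_
    simp only [C, h1, LinearMap.coe_toContinuousLinearMap', LinearMap.comp_apply, h2,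
      Module.Basis.coord_apply]

end Coordinates

/-! ### Reflections, and the projection of `eᵢ p` -/

section MeanValue
variable {m k : ℕ}

theorem norm_shear {t : E m} (ht : ‖t‖ = 1) (u : E m) : ‖shear 2 t u‖ = ‖u‖ := by
  have h : ‖shear 2 t u‖ ^ 2 = ‖u‖ ^ 2 := by
    rw [shear, norm_sub_sq_real, inner_smul_right, norm_smul, ht, real_inner_comm, mul_one,
      Real.norm_eq_abs, sq_abs]
    ring
  exact (sq_eq_sq₀ (norm_nonneg _) (norm_nonneg _)).1 h

theorem exists_smul_sphere {x : E m} (hx : x ≠ 0) :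
    ∃ t : sphere (0 : E m) 1, x = ‖x‖ • (t : E m) := by
  have hx' : ‖x‖ ≠ 0 := norm_ne_zero_iff.2 hx
  refine ⟨⟨‖x‖⁻¹ • x, ?_⟩, ?_⟩
  · rw [mem_sphere_zero_iff_norm, norm_smul, norm_inv, norm_norm, inv_mul_cancel₀ hx']
  · simp [smul_smul, mul_inv_cancel₀ hx']

theorem norm_shear_inv_norm_sq {x : E m} (hx : x ≠ 0) (u : E m) :
    ‖shear (2 * (‖x‖ ^ 2)⁻¹) x u‖ = ‖u‖ := by
  obtain ⟨t, ht⟩ := exists_smul_sphere hx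
  have h := shear_smul (s := 2) (norm_ne_zero_iff.2 hx) (norm_eq_of_mem_sphere t) u
  rw [← ht] at h
  rw [h, norm_shear (norm_eq_of_mem_sphere t)]

theorem inv_norm_sq_smul_sandwich {x : E m} (hx : x ≠ 0) (u : E m) :
    (‖x‖ ^ 2)⁻¹ • sandwich m x u = shear (2 * (‖x‖ ^ 2)⁻¹) x u := by
  have hx' : ‖x‖ ^ 2 ≠ 0 := pow_ne_zero 2 (norm_ne_zero_iff.2 hx)
  rw [sandwich, shear, real_inner_self_eq_norm_sq, smul_sub, smul_smul, smul_smul,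
    inv_mul_cancel₀ hx', one_smul]
  congr 2
  ring

theorem sandwich_eq_shear {t : E m} (ht : ‖t‖ = 1) (u : E m) : sandwich m t u = shear 2 t u := by
  have h := inv_norm_sq_smul_sandwich (norm_ne_zero_iff.1 (ht ▸ one_ne_zero)) u
  simpa [ht] using h

/-- `P_{k,w}(e_i p)`. -/
theorem fischerProj_vec_mul {p : E m → Cl m} (hp : p ∈ monogenicPoly m k) (i : Fin m) (w : E m) :
    fischerProj m k (fun w => vec m (e m i) * p w) w = vec m (e m i) * p w -
      (2 * ((m : ℝ) + 2 * k - 2)⁻¹) • (vec m w * fderiv ℝ p w (e m i)) := by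
  have h1 : fderiv ℝ (fun w => vec m (e m i) * p w) w = _ :=
    (hasFDerivAt_const_mul (vec m (e m i)) (hp.1.differentiable w).hasFDerivAt).fderiv
  have hin : ∀ j, inner ℝ (e m j) (e m i) = if j = i then (1 : ℝ) else 0 := fun j => by
    rw [EuclideanSpace.inner_single_left, PiLp.single_apply, map_one, one_mul]
  have h2 : ∀ j, vec m (e m j) * (vec m (e m i) * fderiv ℝ p w (e m j)) =
      (if j = i then (-2 : ℝ) else 0) • fderiv ℝ p w (e m j) -
        vec m (e m i) * (vec m (e m j) * fderiv ℝ p w (e m j)) := fun j => by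
    rw [eq_sub_iff_add_eq, vec_mul_vec_mul_add_swap, hin]
    simp
  have h3 : dirac m (fun w => vec m (e m i) * p w) w = (-2 : ℝ) • fderiv ℝ p w (e m i) := by
    simp only [dirac, h1, ContinuousLinearMap.comp_apply, mulCLM_apply, h2,
      Finset.sum_sub_distrib, ← Finset.mul_sum]
    rw [show ∑ j, vec m (e m j) * fderiv ℝ p w (e m j) = 0 from hp.2 w, mul_zero, sub_zero]
    simp [ite_smul]
  rw [fischerProj, h3, mul_smul_comm, smul_smul]
  module

/-- `cauchyField` in terms of the projection of `eᵢ p`, by `x w = -u x`. -/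
theorem cauchyField_eq {p : E m → Cl m} (hp : p ∈ monogenicPoly m k) (u : E m) (i : Fin m)
    {x : E m} (hx : x ≠ 0) :
    cauchyField m k p u i x = (‖x‖ ^ m)⁻¹ • (vec m x *
      fischerProj m k (fun w => vec m (e m i) * p w) (shear (2 * (‖x‖ ^ 2)⁻¹) x u)) := by
  have hx' : ‖x‖ ^ 2 ≠ 0 := pow_ne_zero 2 (norm_ne_zero_iff.2 hx)
  have h1 : ∀ a, vec m x * (vec m (shear (2 * (‖x‖ ^ 2)⁻¹) x u) * a) =
      -(vec m u * (vec m x * a)) := fun a => by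
    rw [shear, map_sub, map_smul, sub_mul, mul_sub, smul_mul_assoc, mul_smul_comm,
      vec_mul_self_mul, ← sub_eq_zero]
    have h := vec_mul_vec_mul_add_swap x u a
    rw [eq_sub_of_add_eq h]
    match_scalars
    · field_simp
      ring
    · ring
  rw [cauchyField, fischerProj_vec_mul hp, mul_sub, mul_smul_comm, h1, smul_neg, sub_neg_eq_add]

theorem divergence_sum_smul {n : ℕ} {U : Set (E m)} (hU : IsOpen U)
    {c : Fin n → E m → ℝ} {F : Fin n → Fin m → E m → Cl m}
    (hc : ∀ j, ContDiffOn ℝ 1 (c j) U) (hF : ∀ j i, ContDiffOn ℝ 1 (F j i) U) {x : E m}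
    (hx : x ∈ U) :
    divergence (fun i x => ∑ j, c j x • F j i x) x =
      ∑ j, c j x • divergence (F j) x + ∑ j, ∑ i, fderiv ℝ (c j) x (e m i) • F j i x := by
  have h1 : ∀ i, fderiv ℝ (fun x => ∑ j, c j x • F j i x) x =
      ∑ j, (c j x • fderiv ℝ (F j i) x + (fderiv ℝ (c j) x).smulRight (F j i x)) := by
    intro i
    refine HasFDerivAt.fderiv (HasFDerivAt.fun_sum fun j _ => HasFDerivAt.fun_smul ?_ ?_)
    · exact (((hc j).contDiffAt (hU.mem_nhds hx)).differentiableAt one_ne_zero).hasFDerivAt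
    · exact (((hF j i).contDiffAt (hU.mem_nhds hx)).differentiableAt one_ne_zero).hasFDerivAt
  simp only [divergence, h1, sum_apply, add_apply, smul_apply,
    ContinuousLinearMap.smulRight_apply, Finset.sum_add_distrib, Finset.smul_sum]
  rw [Finset.sum_comm]
  congr 1
  exact Finset.sum_comm

end MeanValue

/-! ### Conservation of the flux and the mean value property -/

section Assembly
variable {m k n : ℕ} {Ω : Set (E m)} {f : E m → E m → Cl m} {b : Fin n → E m → Cl m}
  {c : Fin n → E m → ℝ}

/-- The equation `R_k f = 0` in coordinates. -/
theorem sum_fderiv_smul_fischerProj_eq_zero (hΩ : IsOpen Ω) (hb : ∀ j, b j ∈ monogenicPoly m k)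
    (hc : ∀ j, ContDiffOn ℝ 1 (c j) Ω)
    (hf : ∀ x ∈ closure Ω, ∀ w ∈ closedBall (0 : E m) 1, f x w = ∑ j, c j x • b j w)
    {x w : E m} (hx : x ∈ Ω) (hw : w ∈ ball (0 : E m) 1)
    (hR : raritaSchwinger m k f x w = 0) :
    ∑ j, ∑ i, fderiv ℝ (c j) x (e m i) • fischerProj m k (fun w => vec m (e m i) * b j w) w = 0 := by
  rw [← hR, raritaSchwinger]
  have h1 : (fun w => dirac m (fun z => f z w) x) =ᶠ[nhds w] fun w =>
      ∑ a : Fin n × Fin m, fderiv ℝ (c a.1) x (e m a.2) • (vec m (e m a.2) * b a.1 w) := by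
    filter_upwards [isOpen_ball.mem_nhds hw] with w' hw'
    have h2 : (fun z => f z w') =ᶠ[nhds x] fun z => ∑ j, c j z • b j w' := by
      filter_upwards [hΩ.mem_nhds hx] with z hz
      exact hf z (subset_closure hz) w' (ball_subset_closedBall hw')
    have h3 : HasFDerivAt (fun z => ∑ j, c j z • b j w')
        (∑ j, (fderiv ℝ (c j) x).smulRight (b j w')) x :=
      HasFDerivAt.fun_sum fun j _ =>
        (((hc j).contDiffAt (hΩ.mem_nhds hx)).differentiableAt one_ne_zero).hasFDerivAt.smul_const _
    simp only [dirac, h2.fderiv_eq, h3.fderiv, sum_apply, ContinuousLinearMap.smulRight_apply,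
      Finset.mul_sum, mul_smul_comm]
    rw [Finset.sum_comm, Fintype.sum_prod_type]
  rw [fischerProj_congr h1, fischerProj_sum_smul Finset.univ
    (fun a : Fin n × Fin m => fderiv ℝ (c a.1) x (e m a.2)), Fintype.sum_prod_type]
  exact fun a => (hasFDerivAt_const_mul _ ((hb a.1).1.differentiable w).hasFDerivAt).differentiableAt

/-- The integral over the unit sphere of `P_k f(y + s t, t u t̃)`, in coordinates. -/
def sphereIntegral (m k : ℕ) (b : Fin n → E m → Cl m) (c : Fin n → E m → ℝ) (y u : E m) (s : ℝ) :
    Cl m :=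
  ∫ t : sphere (0 : E m) 1, ∑ j, c j (y + s • (t : E m)) •
    fischerProj m k (fun w => b j (shear 2 t w)) u ∂sphereMeasure m

theorem add_mem_ball {y x : E m} {r : ℝ} : y + x ∈ ball y r ↔ x ∈ ball (0 : E m) r := by
  simp

/-- Conservation of the flux: the integrals over concentric spheres agree. The hypothesis `hR` is the
equation `R_k f = 0` in coordinates, on the sphere `|w| = |u|` that contains all `x u x̃ / |x|²`. -/
theorem sphereIntegral_eq_of_mem_Ioo (hm : 3 ≤ m) (hb : ∀ j, b j ∈ monogenicPoly m k) {y : E m}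
    {r : ℝ} (hc : ∀ j, ContDiffOn ℝ 1 (c j) (ball y r)) {u : E m}
    (hR : ∀ x ∈ ball y r, ∀ w : E m, ‖w‖ = ‖u‖ → ∑ j, ∑ i, fderiv ℝ (c j) x (e m i) •
      fischerProj m k (fun w => vec m (e m i) * b j w) w = 0)
    {s₁ s₂ : ℝ} (h₁ : s₁ ∈ Ioo 0 r) (h₂ : s₂ ∈ Ioo 0 r) :
    sphereIntegral m k b c y u s₁ = sphereIntegral m k b c y u s₂ := by
  have hU : IsOpen (ball (0 : E m) r \ {0}) := isOpen_ball.sdiff isClosed_singleton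
  have hc' : ∀ j, ContDiffOn ℝ 1 (fun x => c j (y + x)) (ball (0 : E m) r \ {0}) := fun j =>
    (hc j).comp (contDiff_const.add contDiff_id).contDiffOn fun x hx => add_mem_ball.2 hx.1
  have hF : ∀ j i, ContDiffOn ℝ 1 (cauchyField m k (b j) u i) (ball (0 : E m) r \ {0}) :=
    fun j i => (contDiffOn_cauchyField (hb j) u i).mono fun x hx => hx.2
  have hdiv : ∀ x ∈ ball (0 : E m) r \ {0},
      divergence (fun i x => ∑ j, c j (y + x) • cauchyField m k (b j) u i x) x = 0 := by
    intro x hx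
    rw [divergence_sum_smul (c := fun j x => c j (y + x)) hU hc' hF hx]
    -- The terms in which the `cauchyField`s are differentiated vanish by themselves, those in which
    -- the `cⱼ` are differentiated vanish by `hR` at the point `x u x̃ / |x|²`.
    have h1 : ∑ j, c j (y + x) • divergence (cauchyField m k (b j) u) x = 0 :=
      Finset.sum_eq_zero fun j _ => by rw [divergence_cauchyField hm (hb j) u hx.2, smul_zero]
    have h2 := hR (y + x) (add_mem_ball.2 hx.1) _ (norm_shear_inv_norm_sq hx.2 u)
    simp only [fderiv_comp_add_left]
    rw [h1, zero_add]
    simp only [cauchyField_eq (hb _) u _ hx.2, smul_comm _ (‖x‖ ^ m)⁻¹, ← mul_smul_comm,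
      ← Finset.smul_sum, ← Finset.mul_sum, h2, mul_zero, smul_zero]
  have hflux : ∀ s ∈ Ioo 0 r, s ^ (m - 1) • (∫ t : sphere (0 : E m) 1,
      ∑ i, (t : E m) i • ∑ j, c j (y + s • (t : E m)) • cauchyField m k (b j) u i (s • (t : E m))
        ∂sphereMeasure m) = -sphereIntegral m k b c y u s := by
    intro s hs
    rw [sphereIntegral, ← integral_smul, ← integral_neg]
    congr 1
    funext t
    have ht : ‖(t : E m)‖ = 1 := norm_eq_of_mem_sphere t
    have hst : ‖s • (t : E m)‖ = s := by
      rw [norm_smul, ht, mul_one, Real.norm_of_nonneg hs.1.le]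
    have h1 : ∀ j, s • ∑ i, (t : E m) i • cauchyField m k (b j) u i (s • (t : E m)) =
        -((s ^ m)⁻¹ * s ^ 2) • fischerProj m k (fun w => b j (shear 2 t w)) u := by
      intro j
      have h := sum_smul_cauchyField (hb j) u (smul_mem_punctured_ball hs t).2
      have h3 : ∀ w, shear (2 * (‖s • (t : E m)‖ ^ 2)⁻¹) (s • (t : E m)) w = shear 2 t w :=
        fun w => shear_smul hs.1.ne' ht w
      simp only [h3] at h
      rw [hst] at h
      rw [← h, Finset.smul_sum]
      refine Finset.sum_congr rfl fun i _ => ?_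
      rw [smul_smul]
      rfl
    have h2 : ∀ j, ∑ i, (t : E m) i • cauchyField m k (b j) u i (s • (t : E m)) =
        -((s ^ m)⁻¹ * s) • fischerProj m k (fun w => b j (shear 2 t w)) u := by
      intro j
      apply smul_right_injective _ hs.1.ne'
      simp only
      rw [h1, smul_smul]
      congr 1
      ring
    simp only [Finset.smul_sum]
    rw [Finset.sum_comm, ← Finset.sum_neg_distrib]
    refine Finset.sum_congr rfl fun j _ => ?_
    have h4 : ∑ i, s ^ (m - 1) • (t : E m) i • c j (y + s • (t : E m)) •
        cauchyField m k (b j) u i (s • (t : E m)) = (s ^ (m - 1) * c j (y + s • (t : E m))) •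
          ∑ i, (t : E m) i • cauchyField m k (b j) u i (s • (t : E m)) := by
      rw [Finset.smul_sum]
      refine Finset.sum_congr rfl fun i _ => ?_
      simp only [smul_smul]
      congr 1
      ring
    rw [h4, h2, smul_smul, ← neg_smul]
    congr 1
    obtain ⟨d, rfl⟩ : ∃ d, m = d + 1 := ⟨m - 1, by omega⟩
    have := hs.1.ne'
    simp only [Nat.add_sub_cancel]
    field_simp
    ring
  have key := flux_sub_flux_eq_integral_divergence (by omega)
    (F := fun i x => ∑ j, c j (y + x) • cauchyField m k (b j) u i x)
    (fun i => ContDiffOn.sum fun j _ => (hc' j).fun_smul (hF j i)) h₁ h₂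
  rw [hflux _ h₁, hflux _ h₂, intervalIntegral.integral_congr (g := fun _ => 0),
    intervalIntegral.integral_zero] at key
  · have := sub_eq_zero.1 key
    exact (neg_injective this).symm
  · intro a ha
    have ha' : a ∈ Ioo 0 r := ordConnected_Ioo.uIcc_subset h₁ h₂ ha
    simp only [hdiv _ (smul_mem_punctured_ball ha' _), integral_zero, smul_zero]

theorem add_smul_mem_closedBall {y : E m} {r s : ℝ} (hs : s ∈ Icc 0 r) (t : sphere (0 : E m) 1) :
    y + s • (t : E m) ∈ closedBall y r := by
  rw [mem_closedBall_iff_norm, add_sub_cancel_left, norm_smul, norm_eq_of_mem_sphere t, mul_one,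
    Real.norm_of_nonneg hs.1]
  exact hs.2

theorem continuous_sphere_integrand (hb : ∀ j, b j ∈ monogenicPoly m k) {y : E m} {r : ℝ}
    (hc : ∀ j, ContinuousOn (c j) (closedBall y r)) (u : E m) {X : Type*} [TopologicalSpace X]
    {s : X → ℝ} {t : X → sphere (0 : E m) 1} (hs : Continuous s) (ht : Continuous t)
    (hsr : ∀ z, s z ∈ Icc 0 r) :
    Continuous fun z => ∑ j, c j (y + s z • (t z : E m)) •
      fischerProj m k (fun w => b j (shear 2 (t z) w)) u := by
  have htv : Continuous fun z => (t z : E m) := continuous_subtype_val.comp ht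
  refine continuous_finsetSum _ fun j _ => Continuous.fun_smul ?_
    ((continuous_fischerProj_comp_shear (hb j) 2 u).comp ht)
  exact (hc j).comp_continuous (continuous_const.add (hs.smul htv))
    fun z => add_smul_mem_closedBall (hsr z) _

theorem sphereIntegral_zero (hm : 3 ≤ m) (hb : ∀ j, b j ∈ monogenicPoly m k) (y u : E m) :
    sphereIntegral m k b c y u 0 = (sphereArea m * cConst m k) • ∑ j, c j y • b j u := by
  simp only [sphereIntegral, zero_smul, add_zero]
  rw [integral_finsetSum _ fun j _ => integrable_sphere
    ((continuous_fischerProj_comp_shear (hb j) 2 u).fun_const_smul (c j y))]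
  rw [Finset.smul_sum]
  refine Finset.sum_congr rfl fun j _ => ?_
  rw [integral_smul, integral_fischerProj_comp_reflection hm (hb j), smul_comm]

/-- The integrals over the concentric spheres agree with the limit at the centre. -/
theorem sphereIntegral_eq (hm : 3 ≤ m) (hb : ∀ j, b j ∈ monogenicPoly m k) {y : E m}
    {r : ℝ} (hr : 0 < r) (hc : ∀ j, ContDiffOn ℝ 1 (c j) (ball y r))
    (hc' : ∀ j, ContinuousOn (c j) (closedBall y r)) {u : E m}
    (hR : ∀ x ∈ ball y r, ∀ w : E m, ‖w‖ = ‖u‖ → ∑ j, ∑ i, fderiv ℝ (c j) x (e m i) •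
      fischerProj m k (fun w => vec m (e m i) * b j w) w = 0)
    {s : ℝ} (hs : s ∈ Icc 0 r) :
    sphereIntegral m k b c y u s = (sphereArea m * cConst m k) • ∑ j, c j y • b j u := by
  have hcont : ContinuousOn (sphereIntegral m k b c y u) (Icc 0 r) := by
    rw [continuousOn_iff_continuous_domRestrict]
    have h := continuous_parametric_integral_of_continuous (μ := sphereMeasure m)
      (f := fun (a : Icc 0 r) (t : sphere (0 : E m) 1) => ∑ j, c j (y + (a : ℝ) • (t : E m)) •
        fischerProj m k (fun w => b j (shear 2 t w)) u) (s := univ)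
      (continuous_sphere_integrand hb hc' u (continuous_subtype_val.comp continuous_fst)
        continuous_snd fun z => z.1.2) isCompact_univ
    simp only [Measure.restrict_univ] at h
    exact h
  have hmid : r / 2 ∈ Ioo 0 r := ⟨by linarith, by linarith⟩
  have hEq : EqOn (sphereIntegral m k b c y u) (fun _ => sphereIntegral m k b c y u (r / 2))
      (Icc 0 r) := by
    refine EqOn.of_subset_closure (s := Ioo 0 r)
      (fun s hs => sphereIntegral_eq_of_mem_Ioo hm hb hc hR hs hmid)
      hcont continuousOn_const Ioo_subset_Icc_self ?_
    rw [closure_Ioo hr.ne]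
  rw [hEq hs, ← hEq ⟨le_rfl, hr.le⟩, sphereIntegral_zero hm hb]

theorem sphereArea_eq : sphereArea m = m * (volume : Measure (E m)).real (ball 0 1) := by
  rw [sphereArea, sphereMeasure, Measure.toSphere_real_apply_univ, finrank_euclideanSpace_fin]

theorem volume_real_ball (y : E m) {r : ℝ} (hr : 0 < r) :
    (m : ℝ) * (volume : Measure (E m)).real (ball y r) = r ^ m * sphereArea m := by
  rw [sphereArea_eq, Measure.real, Measure.addHaar_ball_of_pos _ _ hr, finrank_euclideanSpace_fin,
    ENNReal.toReal_mul, ENNReal.toReal_ofReal (pow_nonneg hr.le _), Measure.real]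
  ring

theorem sphereArea_pos (hm : 0 < m) : 0 < sphereArea m := by
  rw [sphereArea_eq]
  have h : 0 < (volume : Measure (E m)).real (ball 0 1) :=
    ENNReal.toReal_pos (measure_ball_pos _ _ one_pos).ne' measure_ball_lt_top.ne
  positivity

theorem cConst_pos (hm : 3 ≤ m) : 0 < cConst m k := by
  have : (3 : ℝ) ≤ m := by exact_mod_cast hm
  have : (0 : ℝ) ≤ k := k.cast_nonneg
  exact div_pos (by linarith) (by linarith)

/-- A function which is continuous in polar coordinates, up to radius zero, is integrable on the
punctured ball. It may be discontinuous at the centre, so its value there plays no role. -/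
theorem integrableOn_ball_of_polar {V : Type*} [NormedAddCommGroup V] {y : E m} {r : ℝ}
    {g : E m → V} {H : Icc 0 r × sphere (0 : E m) 1 → V} (hH : Continuous H)
    (hg : ∀ (s : ℝ) (hs : s ∈ Ioo 0 r) (t : sphere (0 : E m) 1),
      g (y + s • (t : E m)) = H (⟨s, Ioo_subset_Icc_self hs⟩, t)) :
    IntegrableOn g (ball y r \ {y}) := by
  obtain ⟨C, hC⟩ := isCompact_univ.exists_bound_of_continuousOn hH.continuousOn
  have hpos : ∀ x ∈ ball y r \ {y}, ‖x - y‖ ∈ Ioo 0 r := fun x hx =>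
    ⟨norm_pos_iff.2 (sub_ne_zero.2 hx.2), mem_ball_iff_norm.1 hx.1⟩
  have hsph : ∀ x ∈ ball y r \ {y}, ‖x - y‖⁻¹ • (x - y) ∈ sphere (0 : E m) 1 := fun x hx => by
    rw [mem_sphere_zero_iff_norm, norm_smul, norm_inv, norm_norm, inv_mul_cancel₀ (hpos x hx).1.ne']
  have hgH : ∀ (x : E m) (hx : x ∈ ball y r \ {y}), g x =
      H (⟨‖x - y‖, Ioo_subset_Icc_self (hpos x hx)⟩, ⟨‖x - y‖⁻¹ • (x - y), hsph x hx⟩) :=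
    fun x hx => by
      rw [← hg _ (hpos x hx)]
      simp [smul_smul, mul_inv_cancel₀ (hpos x hx).1.ne']
  have hcont : ContinuousOn g (ball y r \ {y}) := by
    rw [continuousOn_iff_continuous_domRestrict]
    have h1 : Continuous fun x : (ball y r \ {y} : Set (E m)) => ‖(x : E m) - y‖ := by fun_prop
    have h2 : Continuous fun x : (ball y r \ {y} : Set (E m)) =>
        H (⟨‖(x : E m) - y‖, Ioo_subset_Icc_self (hpos x x.2)⟩,
          ⟨‖(x : E m) - y‖⁻¹ • ((x : E m) - y), hsph x x.2⟩) := by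
      refine hH.comp ((h1.subtype_mk _).prodMk (Continuous.subtype_mk ?_ _))
      exact (h1.inv₀ fun x => (hpos x x.2).1.ne').smul (by fun_prop)
    exact h2.congr fun x => (hgH x x.2).symm
  have hmeas : MeasurableSet (ball y r \ {y}) := measurableSet_ball.diff (measurableSet_singleton y)
  have hfin : IsFiniteMeasure (volume.restrict (ball y r \ {y})) :=
    isFiniteMeasure_restrict.2 ((measure_mono sdiff_subset).trans_lt measure_ball_lt_top).ne
  refine Integrable.of_bound (hcont.aestronglyMeasurable hmeas) C ?_
  rw [ae_restrict_iff' hmeas]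
  refine .of_forall fun x hx => ?_
  rw [hgH x hx]
  exact hC _ (mem_univ _)

/-- Integration over a ball of a function whose integral over the concentric spheres is constant. -/
theorem integral_ball_eq_of_sphere (hm : 0 < m) {y : E m} {r : ℝ} (hr : 0 < r) {g : E m → Cl m}
    (hg : IntegrableOn g (ball y r)) {a : Cl m}
    (hs : ∀ s ∈ Ioo 0 r, ∫ t : sphere (0 : E m) 1, g (y + s • (t : E m)) ∂sphereMeasure m = a) :
    ∫ x in ball y r, g x = (r ^ m / m) • a := by
  have hg' : Integrable (fun x => (ball y r).indicator g (y + x)) :=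
    ((integrable_indicator_iff measurableSet_ball).2 hg).comp_add_left y
  rw [← integral_indicator measurableSet_ball, ← integral_add_left_eq_self _ y,
    integral_eq_integral_polar hm hg', ← integral_indicator measurableSet_Ioi]
  have h1 : (Ioi (0 : ℝ)).indicator (fun s => s ^ (m - 1) • ∫ t : sphere (0 : E m) 1,
      (ball y r).indicator g (y + s • (t : E m)) ∂sphereMeasure m) =
      (Ioo 0 r).indicator fun s => s ^ (m - 1) • a := by
    funext s
    by_cases h0 : 0 < s
    · have hmem : ∀ t : sphere (0 : E m) 1, y + s • (t : E m) ∈ ball y r ↔ s < r := fun t => by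
        rw [add_mem_ball, mem_ball_zero_iff, norm_smul, norm_eq_of_mem_sphere t, mul_one,
          Real.norm_of_nonneg h0.le]
      rw [indicator_of_mem (mem_Ioi.2 h0)]
      by_cases hsr : s < r
      · rw [indicator_of_mem (mem_Ioo.2 ⟨h0, hsr⟩), ← hs s ⟨h0, hsr⟩]
        congr 2
        funext t
        exact indicator_of_mem ((hmem t).2 hsr) g
      · rw [indicator_of_notMem fun h : s ∈ Ioo 0 r => hsr h.2, integral_eq_zero_of_ae, smul_zero]
        exact .of_forall fun t => indicator_of_notMem (fun h => hsr ((hmem t).1 h)) g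
    · rw [indicator_of_notMem (by simpa using h0), indicator_of_notMem fun h : s ∈ Ioo 0 r => h0 h.1]
  rw [h1, integral_indicator measurableSet_Ioo, ← integral_Ioc_eq_integral_Ioo,
    ← intervalIntegral.integral_of_le hr.le, intervalIntegral.integral_smul_const, integral_pow]
  obtain ⟨d, rfl⟩ : ∃ d, m = d + 1 := ⟨m - 1, by omega⟩
  simp

end Assembly

end Fermionic

end

open Fermionic in
theorem mainTheorem2 (m k : ℕ) (hm : 3 ≤ m) (Ω : Set (E m)) (hΩ : IsOpen Ω)
    (f : E m → E m → Cl m)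
    (hfM : MonogenicValuedOn m k f (closure Ω))
    (hfC1 : ContDiffOn ℝ 1 (fun z : E m × E m => f z.1 z.2) (Ω ×ˢ ball 0 1))
    (hfC : ContinuousOn (fun z : E m × E m => f z.1 z.2) (closure Ω ×ˢ closedBall 0 1))
    (hR : ∀ x ∈ Ω, ∀ u ∈ ball (0 : E m) 1, raritaSchwinger m k f x u = 0)
    (y : E m) (r : ℝ) (hr : 0 < r) (hball : ball y r ⊆ Ω)
    (u : E m) (hu : u ∈ ball (0 : E m) 1) :
    (Integrable (fun t : sphere (0 : E m) 1 =>
        fischerProj m k (fun w => f (y + r • (t : E m)) (sandwich m t w)) u) (sphereMeasure m) ∧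
      f y u = (1 / (sphereArea m * cConst m k)) •
        ∫ t : sphere (0 : E m) 1,
          fischerProj m k (fun w => f (y + r • (t : E m)) (sandwich m t w)) u ∂(sphereMeasure m)) ∧
    (IntegrableOn (fun x : E m =>
        fischerProj m k (fun w => f x ((‖x - y‖ ^ 2)⁻¹ • sandwich m (x - y) w)) u) (ball y r) ∧
      f y u = (1 / (cConst m k * volume.real (ball y r))) •
        ∫ x in ball y r,
          fischerProj m k (fun w => f x ((‖x - y‖ ^ 2)⁻¹ • sandwich m (x - y) w)) u) := by
  obtain ⟨n, b, c, hb, hc1, hc, hf⟩ := exists_monogenic_coordinates hfM hfC1 hfC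
  have hcl : closedBall y r ⊆ closure Ω := by
    rw [← closure_ball y hr.ne']
    exact closure_mono hball
  have hc1' : ∀ j, ContDiffOn ℝ 1 (c j) (ball y r) := fun j => (hc1 j).mono hball
  have hc' : ∀ j, ContinuousOn (c j) (closedBall y r) := fun j => (hc j).mono hcl
  have hmean : ∀ s ∈ Icc 0 r, sphereIntegral m k b c y u s =
      (sphereArea m * cConst m k) • f y u := by
    intro s hs
    rw [hf y (hcl (mem_closedBall_self hr.le)) u (ball_subset_closedBall hu)]
    refine sphereIntegral_eq hm hb hr hc1' hc' (fun x hx w hw => ?_) hs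
    have hw' : w ∈ ball (0 : E m) 1 := by
      rw [mem_ball_zero_iff] at hu ⊢
      rwa [hw]
    exact sum_fderiv_smul_fischerProj_eq_zero hΩ hb hc1 hf (hball hx) hw' (hR x (hball hx) w hw')
  -- The integrands in coordinates, for `x = y + s t`.
  have hint : ∀ s ∈ Icc 0 r, ∀ t : sphere (0 : E m) 1,
      fischerProj m k (fun w => f (y + s • (t : E m)) (sandwich m t w)) u =
        ∑ j, c j (y + s • (t : E m)) • fischerProj m k (fun w => b j (shear 2 t w)) u := by
    intro s hs t
    have ht : ‖(t : E m)‖ = 1 := norm_eq_of_mem_sphere t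
    rw [← fischerProj_sum_smul _ _ fun j => differentiable_comp_shear (hb j) 2 (t : E m) u]
    refine fischerProj_congr ?_
    filter_upwards [isOpen_ball.mem_nhds hu] with w hw
    rw [sandwich_eq_shear ht, hf _ (hcl (add_smul_mem_closedBall hs t))]
    rw [mem_closedBall_zero_iff, norm_shear ht]
    exact (mem_ball_zero_iff.1 hw).le
  have hω := sphereArea_pos (m := m) (by omega)
  have hck := cConst_pos (k := k) hm
  have hrr : r ∈ Icc 0 r := ⟨hr.le, le_rfl⟩
  refine ⟨⟨?_, ?_⟩, ?_⟩
  · simp only [hint r hrr]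
    exact integrable_sphere (continuous_sphere_integrand hb hc' u continuous_const continuous_id
      fun _ => hrr)
  · simp only [hint r hrr]
    have h := hmean r hrr
    rw [sphereIntegral] at h
    rw [h, smul_smul, one_div, inv_mul_cancel₀ (mul_pos hω hck).ne', one_smul]
  -- In polar coordinates the integrand over the ball is the one over the spheres.
  have hsand : ∀ s : ℝ, 0 < s → ∀ (t : sphere (0 : E m) 1) (w : E m),
      (‖y + s • (t : E m) - y‖ ^ 2)⁻¹ • sandwich m (y + s • (t : E m) - y) w = sandwich m t w := by
    intro s hs t w
    have ht : ‖(t : E m)‖ = 1 := norm_eq_of_mem_sphere t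
    have hne : s • (t : E m) ≠ 0 := by
      rw [← norm_ne_zero_iff, norm_smul, ht, mul_one]
      simpa using hs.ne'
    rw [add_sub_cancel_left, inv_norm_sq_smul_sandwich hne, shear_smul hs.ne' ht,
      sandwich_eq_shear ht]
  have hball_int : IntegrableOn (fun x : E m =>
      fischerProj m k (fun w => f x ((‖x - y‖ ^ 2)⁻¹ • sandwich m (x - y) w)) u) (ball y r) := by
    have : Nonempty (Fin m) := ⟨⟨0, by omega⟩⟩
    have h := integrableOn_ball_of_polar (y := y) (r := r)
      (g := fun x : E m =>
        fischerProj m k (fun w => f x ((‖x - y‖ ^ 2)⁻¹ • sandwich m (x - y) w)) u)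
      (continuous_sphere_integrand hb hc' u
        (X := Icc 0 r × sphere (0 : E m) 1) (continuous_subtype_val.comp continuous_fst)
        continuous_snd fun z => z.1.2) fun s hs t => by
          simp only [hsand s hs.1, hint s ⟨hs.1.le, hs.2.le⟩, Function.comp_apply]
    exact h.congr_set_ae (sdiff_null_ae_eq_self (measure_singleton y)).symm
  refine ⟨hball_int, ?_⟩
  rw [integral_ball_eq_of_sphere (by omega) hr hball_int (a := (sphereArea m * cConst m k) • f y u)]
  · have hv := volume_real_ball y hr
    have hm0 : (m : ℝ) ≠ 0 := by
      have : (0 : ℝ) < m := by exact_mod_cast (by omega : 0 < m)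
      exact this.ne'
    have hV : volume.real (ball y r) = r ^ m * sphereArea m / m := by
      rw [← hv]
      field_simp
    rw [smul_smul, smul_smul, hV]
    have : 1 / (cConst m k * (r ^ m * sphereArea m / m)) *
        (r ^ m / m) * (sphereArea m * cConst m k) = 1 := by
      have := hω.ne'
      have := hck.ne'
      have := hr.ne'
      field_simp
    rw [this, one_smul]
  · intro s hs
    simp only [hsand s hs.1, hint s ⟨hs.1.le, hs.2.le⟩]
    exact hmean s ⟨hs.1.le, hs.2.le⟩
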